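/- Let $p$ be a prime and, for a positive integer $m$, let $[m]_p$ denote the highest power of $p$ dividing $m$. A $p$-hook in a partition $\lambda$ is a connected part of the rim of the Young diagram of $\lambda$ consisting of exactly $p$ boxes, whose removal leaves the diagram of a partition. A partition with no $p$-hook is a $p$-core; a partition $\mu$ has $p$-core $\gamma$ and weight $w$ if successively removing $w$ $p$-hooks turns $\mu$ into the $p$-core $\gamma$. For a partition $\mu$ of $n$ let $S^\mu$ be the Specht module over a field $F$ (of any characteristic), that is, the span of all $\mu$-polytabloids in the Young permutation module $M^\mu_F$ with basis the $\mu$-tabloids; $\dim$ means dimension over $F$. Let $\gamma=(\gamma_1,\ldots,\gamma_k)$ be a $p$-core, let $w$ be a non-negative integer, put $n=|\gamma|+wp$, and let $\gamma+wp=(\gamma_1+wp,\gamma_2,\ldots,\gamma_k)$ (which is $(wp)$ if $\gamma$ is empty). If $[n!]_p=p^a$ and $[(wp)!]_p=p^b$, then \[ [\dim S^{\gamma+wp}]_p=p^{a-b}. \] Moreover, if $\mu$ is any other partition with $p$-core $\gamma$ and weight $w$, then \[ [\dim S^\mu]_p\ge p^{a-b}. \] -/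

import Mathlib

namespace YoungDiagram

/-! ### Tabloids and Specht modules -/

/-- A `μ`-tableau: a bijective filling of the boxes of `μ` by `n = |μ|` entries, here the elements
of `Fin n`. -/
abbrev Tableau (μ : YoungDiagram) : Type :=
  {c : ℕ × ℕ // c ∈ μ.cells} ≃ Fin μ.card

/-- The row of the tableau `t` that contains the entry `x`. -/
def Tableau.rowOf {μ : YoungDiagram} (t : μ.Tableau) (x : Fin μ.card) : ℕ :=
  (t.symm x).1.1

/-- The column of the tableau `t` that contains the entry `x`. -/
def Tableau.colOf {μ : YoungDiagram} (t : μ.Tableau) (x : Fin μ.card) : ℕ :=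
  (t.symm x).1.2

/-- The action of the symmetric group on tableaux: `g` is applied to every entry. -/
def Tableau.permute {μ : YoungDiagram} (t : μ.Tableau) (g : Equiv.Perm (Fin μ.card)) : μ.Tableau :=
  t.trans g

/-- Two tableaux are row equivalent if they differ only by the order of the entries within the
rows, that is, if every entry lies in the same row of both. -/
def rowSetoid (μ : YoungDiagram) : Setoid μ.Tableau where
  r s t := ∀ x, s.rowOf x = t.rowOf x
  iseqv := ⟨fun _ _ => rfl, fun h x => (h x).symm, fun h k x => (h x).trans (k x)⟩

/-- A `μ`-tabloid: a `μ`-tableau up to the order of the entries within the rows. -/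
def Tabloid (μ : YoungDiagram) : Type :=
  Quotient μ.rowSetoid

/-- The tabloid of a tableau. -/
def Tableau.tabloid {μ : YoungDiagram} (t : μ.Tableau) : μ.Tabloid :=
  Quotient.mk μ.rowSetoid t

/-- The underlying `R`-module of the Young permutation module `M^μ`: the free module on the
`μ`-tabloids. -/
abbrev YoungModule (R : Type*) [CommRing R] (μ : YoungDiagram) : Type _ :=
  μ.Tabloid →₀ R

/-- The column stabiliser `C(t)`: the permutations of the entries that fix setwise every column
of `t`. -/
def Tableau.colStabilizer {μ : YoungDiagram} (t : μ.Tableau) :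
    Subgroup (Equiv.Perm (Fin μ.card)) where
  carrier := {g | ∀ x, t.colOf (g x) = t.colOf x}
  mul_mem' {g h} hg hh x := (hg (h x)).trans (hh x)
  one_mem' _ := rfl
  inv_mem' {g} hg x := by simpa using (hg (g⁻¹ x)).symm

instance Tableau.decidableMemColStabilizer {μ : YoungDiagram} (t : μ.Tableau) :
    DecidablePred (· ∈ t.colStabilizer) :=
  fun g => inferInstanceAs (Decidable (∀ x, t.colOf (g x) = t.colOf x))

/-- The polytabloid `e_t`: the sum over `g ∈ C(t)` of `sgn(g)` times the tabloid of `t g`. -/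
noncomputable def Tableau.polytabloid (R : Type*) [CommRing R] {μ : YoungDiagram}
    (t : μ.Tableau) : YoungModule R μ :=
  ∑ g : t.colStabilizer,
    Finsupp.single (t.permute g.1).tabloid (((Equiv.Perm.sign g.1 : ℤˣ) : ℤ) : R)

/-- The Specht module `S^μ` over `R`: the span of all `μ`-polytabloids inside `M^μ`. -/
noncomputable def spechtModule (R : Type*) [CommRing R] (μ : YoungDiagram) :
    Submodule R (YoungModule R μ) :=
  Submodule.span R (Set.range fun t : μ.Tableau => t.polytabloid R)

/-! ### Hooks, cores and weights -/

/-- The rim of a Young diagram: the boxes with no box diagonally below and to the right. -/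
def rim (μ : YoungDiagram) : Set (ℕ × ℕ) :=
  {c | c ∈ μ ∧ (c.1 + 1, c.2 + 1) ∉ μ}

/-- `ν` is obtained from `μ` by removing a `p`-hook: the removed boxes are a connected part of
the rim of `μ` and consist of exactly `p` boxes. Two boxes are adjacent when they share an edge,
which is the covering relation of `ℕ × ℕ`. -/
structure IsHookRemoval (p : ℕ) (μ ν : YoungDiagram) : Prop where
  le : ν ≤ μ
  subset_rim : ((μ.cells \ ν.cells : Finset (ℕ × ℕ)) : Set (ℕ × ℕ)) ⊆ μ.rim
  connected : ((SimpleGraph.hasse (ℕ × ℕ)).induce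
    ((μ.cells \ ν.cells : Finset (ℕ × ℕ)) : Set (ℕ × ℕ))).Connected
  card_eq : (μ.cells \ ν.cells).card = p

/-- `γ` is a `p`-core: it has no `p`-hook. -/
def IsCore (p : ℕ) (γ : YoungDiagram) : Prop :=
  ∀ ν : YoungDiagram, ¬ IsHookRemoval p γ ν

/-- `ν` is obtained from `μ` by successively removing `w` `p`-hooks. -/
def IsHookStripping (p : ℕ) : ℕ → YoungDiagram → YoungDiagram → Prop
  | 0, μ, ν => μ = ν
  | w + 1, μ, ν => ∃ κ : YoungDiagram, IsHookRemoval p μ κ ∧ IsHookStripping p w κ ν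

/-- `μ` has `p`-core `γ` and weight `w`: stripping off `w` `p`-hooks one after the other turns `μ`
into `γ`, and no `p`-hook is left. -/
def HasCoreAndWeight (p : ℕ) (μ γ : YoungDiagram) (w : ℕ) : Prop :=
  IsCore p γ ∧ IsHookStripping p w μ γ

/-- The partition `(γ₁ + m, γ₂, …, γ_k)`; it is `(m)` if `γ` is empty. -/
def addToFirstRow (γ : YoungDiagram) (m : ℕ) : YoungDiagram where
  cells := γ.cells ∪ {0} ×ˢ Finset.range (γ.rowLen 0 + m)
  isLowerSet := by
    rintro ⟨i, j⟩ ⟨i', j'⟩ ⟨hi, hj⟩ h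
    simp only [Finset.coe_union, Set.mem_union, Finset.mem_coe, Finset.mem_product,
      Finset.mem_singleton, Finset.mem_range, mem_cells] at h hi hj ⊢
    rcases h with h | ⟨h0, h⟩
    · exact Or.inl (γ.up_left_mem hi hj h)
    · exact Or.inr ⟨by omega, by omega⟩

end YoungDiagram

/-! Encode a partition by a beta set `S` of `k` beads. The dimension of the Specht module is `n! *
diffProd S / factProd S` over every field, so its `p`-adic valuation is that of `n!` minus `cost p
S`. What remains is to show that `cost p S` is at most the valuation of `(wp)!`, with equality for
the partition got by lengthening the first row of the core.

Differences of beads are divisible by `p` only within a residue class, so the cost splits over the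
runners of the `p`-abacus (`cost_eq_sum_runner`): each runner contributes the size of its partition
plus the cost of its own bead set. Removing a `p`-hook moves a bead one place along its runner, and
a core has all runners flush, so the sizes on the runners add up to `w`. For any bead set,
`factProd` divides `excess! * diffProd`, which bounds the cost of a runner by the valuation of the
factorial of its size; the product of these factorials divides `w!`, and Legendre's formula turns `w
+ v_p(w!)` into `v_p((wp)!)`. Lengthening the first row moves the largest bead only, leaving one
runner with the one-row partition `(w)`, where all bounds are attained.

The dimension formula has two halves. The dimension is the number of lattice words (standard
tableaux): polytabloids of standard tableaux are independent by a leading-term argument, and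
Garnir-type relations show that a Specht vector is determined by its coefficients at standard
tabloids. The number of lattice words and the quotient formula then satisfy the same branching
recurrence, which for the quotient is a partial fraction identity (`sum_quot_move`). -/

/-! ### Beta sets: difference products, factorial products and the branching recurrence -/

namespace BetaSet

open Finset

/-- The product of the differences `x - y` over all pairs `y < x` in `S`. -/
def diffProd (S : Finset ℕ) : ℕ := ∏ x ∈ S, ∏ y ∈ S with y < x, (x - y)

/-- The product of the factorials of the elements of `S`. -/
def factProd (S : Finset ℕ) : ℕ := ∏ x ∈ S, x.factorial

/-- The size of the partition with beta set `S`, as an integer. -/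
def excess (S : Finset ℕ) : ℤ := ∑ x ∈ S, (x : ℤ) - (S.card.choose 2 : ℕ)

/-- The quotient of `diffProd` by `factProd`. -/
def quot (S : Finset ℕ) : ℚ := (diffProd S : ℚ) / factProd S

theorem diffProd_pos (S : Finset ℕ) : 0 < diffProd S :=
  prod_pos fun _ _ => prod_pos fun _ hy => Nat.sub_pos_of_lt (mem_filter.1 hy).2

theorem factProd_pos (S : Finset ℕ) : 0 < factProd S :=
  prod_pos fun _ _ => Nat.factorial_pos _

theorem quot_pos (S : Finset ℕ) : 0 < quot S :=
  div_pos (by exact_mod_cast diffProd_pos S) (by exact_mod_cast factProd_pos S)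

theorem factProd_insert {S : Finset ℕ} {x : ℕ} (hx : x ∉ S) :
    factProd (insert x S) = x.factorial * factProd S := prod_insert hx

theorem diffProd_insert {S : Finset ℕ} {x : ℕ} (hx : x ∉ S) :
    diffProd (insert x S) = (∏ y ∈ S, Nat.dist x y) * diffProd S := by
  unfold diffProd
  rw [prod_insert hx, filter_insert, if_neg (lt_irrefl x)]
  have h1 : ∀ a ∈ S, ∏ y ∈ insert x S with y < a, (a - y)
      = (if x < a then a - x else 1) * ∏ y ∈ S with y < a, (a - y) := by
    intro a _
    rw [filter_insert]
    split_ifs with h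
    · rw [prod_insert (by simp [hx])]
    · simp
  rw [prod_congr rfl h1, prod_mul_distrib, ← mul_assoc, prod_filter, ← prod_mul_distrib]
  congr 1
  refine prod_congr rfl fun y hy => ?_
  have : x ≠ y := fun h => hx (h ▸ hy)
  unfold Nat.dist
  split_ifs <;> omega

theorem excess_insert {S : Finset ℕ} {x : ℕ} (hx : x ∉ S) :
    excess (insert x S) = excess S + x - S.card := by
  unfold excess
  rw [sum_insert hx, card_insert_of_notMem hx, Nat.choose_succ_succ' S.card 1]
  push_cast [Nat.choose_one_right]
  ring

theorem excess_range (k : ℕ) : excess (range k) = 0 := by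
  induction k with
  | zero => simp [excess]
  | succ k ih => rw [range_add_one, excess_insert (by simp), ih]; simp

theorem diffProd_range (k : ℕ) : diffProd (range k) = factProd (range k) := by
  induction k with
  | zero => simp [diffProd, factProd]
  | succ k ih =>
    rw [range_add_one, diffProd_insert (by simp), factProd_insert (by simp), ih]
    congr 1
    rw [← Nat.descFactorial_self, Nat.descFactorial_eq_prod_range]
    refine prod_congr rfl fun i hi => ?_
    rw [Nat.dist_comm, Nat.dist_eq_sub_of_le (mem_range.1 hi).le]

theorem quot_range (k : ℕ) : quot (range k) = 1 := by
  rw [quot, diffProd_range, div_self]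
  exact_mod_cast (factProd_pos _).ne'

/-- A finite set of naturals that is closed under predecessors is an initial segment. -/
theorem eq_range_of_closed {S : Finset ℕ} (h : ∀ x ∈ S, x ≠ 0 → x - 1 ∈ S) :
    S = range S.card := by
  have hd : ∀ x ∈ S, ∀ y ≤ x, y ∈ S := by
    intro x
    induction x with
    | zero => intro hx y hy; rwa [Nat.le_zero.1 hy]
    | succ x ih =>
      intro hx y hy
      rcases Nat.lt_or_ge y (x + 1) with h' | h'
      · exact ih (by simpa using h _ hx (by omega)) y (by omega)
      · rwa [le_antisymm hy h']
  symm
  refine eq_of_superset_of_card_ge (fun x hx => ?_) (by simp)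
  have : range (x + 1) ⊆ S := fun y hy => hd x hx y (by simpa [Nat.lt_succ_iff] using hy)
  have := card_le_card this
  rw [card_range] at this
  exact mem_range.2 this

/-! #### Partial fractions -/

/-- The weight of `x` in the partial fraction expansion of `∏ y ∈ S, (1 - 1 / (z - y))`. -/
def weight (S : Finset ℕ) (x : ℕ) : ℚ := ∏ y ∈ S.erase x, (1 - 1 / ((x : ℚ) - y))

theorem weight_insert_of_mem {S : Finset ℕ} {x u : ℕ} (hx : x ∈ S) (hu : u ∉ S) :
    weight (insert u S) x = (1 - 1 / ((x : ℚ) - u)) * weight S x := by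
  have : u ≠ x := fun h => hu (h ▸ hx)
  rw [weight, erase_insert_of_ne this, prod_insert (by simp [hu]), weight]

theorem weight_insert_self {S : Finset ℕ} {u : ℕ} (hu : u ∉ S) :
    weight (insert u S) u = ∏ y ∈ S, (1 - 1 / ((u : ℚ) - y)) := by
  rw [weight, erase_insert hu]

/-- The left side tends to `1` at infinity and has only simple poles, with residue `-weight S x` at
`x`. In the induction, the value at the new point `u` is supplied by the induction hypothesis at `z
= u`. -/
theorem prod_eq_one_sub_sum_weight (S : Finset ℕ) : ∀ z ∉ S,
    ∏ y ∈ S, (1 - 1 / ((z : ℚ) - y)) = 1 - ∑ x ∈ S, weight S x / ((z : ℚ) - x) := by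
  induction S using Finset.induction_on with
  | empty => simp
  | insert u S hu ih =>
    intro z hz
    rw [mem_insert, not_or] at hz
    have hzu : (z : ℚ) - u ≠ 0 := sub_ne_zero.2 (by exact_mod_cast hz.1)
    rw [prod_insert hu, sum_insert hu, weight_insert_self hu, ih z hz.2, ih u hu]
    have : ∀ x ∈ S, weight (insert u S) x / ((z : ℚ) - x) = weight S x / ((z : ℚ) - x)
        - (weight S x / ((z : ℚ) - x) - weight S x / ((u : ℚ) - x)) / ((z : ℚ) - u) := by
      intro x hx
      have h1 : (x : ℚ) - u ≠ 0 := sub_ne_zero.2 fun h => hu (by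
        have : x = u := by exact_mod_cast h
        exact this ▸ hx)
      have h1' : (u : ℚ) - x ≠ 0 := by rw [← neg_sub]; exact neg_ne_zero.2 h1
      have h2 : (z : ℚ) - x ≠ 0 := sub_ne_zero.2 fun h => hz.2 (by
        have : z = x := by exact_mod_cast h
        exact this ▸ hx)
      rw [weight_insert_of_mem hx hu, show (x : ℚ) - u = -(u - x) by ring]
      field_simp
      ring
    rw [sum_congr rfl this, sum_sub_distrib, ← sum_div, sum_sub_distrib]
    field_simp
    ring

/-- This and `sum_mul_weight` compare the coefficients of `1/z` and `1/z²` in the expansion of the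
partial fraction identity at infinity. -/
theorem sum_weight (S : Finset ℕ) : ∑ x ∈ S, weight S x = S.card := by
  induction S using Finset.induction_on with
  | empty => simp
  | insert u S hu ih =>
    rw [sum_insert hu, card_insert_of_notMem hu, weight_insert_self hu,
      prod_eq_one_sub_sum_weight S u hu]
    have : ∀ x ∈ S, weight (insert u S) x = weight S x + weight S x / ((u : ℚ) - x) := by
      intro x hx
      rw [weight_insert_of_mem hx hu, show (x : ℚ) - u = -(u - x) by ring, div_neg]
      ring
    rw [sum_congr rfl this, sum_add_distrib, ih]
    push_cast
    ring

theorem sum_mul_weight (S : Finset ℕ) : ∑ x ∈ S, (x : ℚ) * weight S x = excess S := by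
  induction S using Finset.induction_on with
  | empty => simp [excess]
  | insert u S hu ih =>
    rw [sum_insert hu, excess_insert hu, weight_insert_self hu,
      prod_eq_one_sub_sum_weight S u hu]
    have : ∀ x ∈ S, (x : ℚ) * weight (insert u S) x
        = x * weight S x - weight S x + u * (weight S x / ((u : ℚ) - x)) := by
      intro x hx
      have h1 : (u : ℚ) - x ≠ 0 := sub_ne_zero.2 fun h => hu (by
        have : u = x := by exact_mod_cast h
        exact this ▸ hx)
      rw [weight_insert_of_mem hx hu, show (x : ℚ) - u = -(u - x) by ring]
      field_simp
      ring
    rw [sum_congr rfl this, sum_add_distrib, sum_sub_distrib, ih, sum_weight, ← mul_sum]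
    push_cast
    ring

/-! #### The recurrence -/

/-- The elements of `S` that can be decreased by `d` without leaving the naturals or meeting
another element of `S`. -/
def movable (d : ℕ) (S : Finset ℕ) : Finset ℕ := {x ∈ S | d ≤ x ∧ x - d ∉ S}

/-- Decrease the element `x` of `S` by `d`. -/
def move (d : ℕ) (S : Finset ℕ) (x : ℕ) : Finset ℕ := insert (x - d) (S.erase x)

/-- Each difference `x - y` is multiplied by `1 - 1/(x - y)`, and `x!` in the denominator loses the
factor `x`. -/
theorem quot_move {S : Finset ℕ} {x : ℕ} (hx : x ∈ movable 1 S) :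
    quot (move 1 S x) = quot S * (x * weight S x) := by
  obtain ⟨hxS, h1, h2⟩ : x ∈ S ∧ 1 ≤ x ∧ x - 1 ∉ S := by simpa [movable] using hx
  have key : ∏ y ∈ S.erase x, (Nat.dist (x - 1) y : ℚ)
      = (∏ y ∈ S.erase x, (Nat.dist x y : ℚ)) * weight S x := by
    rw [weight, ← prod_mul_distrib]
    refine prod_congr rfl fun y hy => ?_
    obtain ⟨hyx, hy⟩ := mem_erase.1 hy
    have hy1 : y ≠ x - 1 := fun h => h2 (h ▸ hy)
    have h0 : (x : ℚ) - y ≠ 0 := sub_ne_zero.2 (by exact_mod_cast hyx.symm)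
    rcases lt_or_gt_of_ne hyx with h | h
    · rw [Nat.dist_comm, Nat.dist_eq_sub_of_le (by omega), Nat.dist_comm x,
        Nat.dist_eq_sub_of_le (by omega), Nat.cast_sub (show y ≤ x - 1 by omega), Nat.cast_sub h1,
        Nat.cast_sub h.le]
      field_simp
      push_cast
      ring
    · rw [Nat.dist_eq_sub_of_le (by omega), Nat.dist_eq_sub_of_le (by omega),
        Nat.cast_sub (show x - 1 ≤ y by omega), Nat.cast_sub h1, Nat.cast_sub h.le]
      field_simp
      push_cast
      ring
  have hS : quot S = quot (insert x (S.erase x)) := by rw [insert_erase hxS]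
  have h2' : x - 1 ∉ S.erase x := fun h => h2 (mem_of_mem_erase h)
  rw [hS, move, quot, quot, diffProd_insert h2', diffProd_insert (notMem_erase x S),
    factProd_insert h2', factProd_insert (notMem_erase x S)]
  push_cast
  rw [key, ← Nat.mul_factorial_pred (by omega : x ≠ 0)]
  have hf : (factProd (S.erase x) : ℚ) ≠ 0 := by exact_mod_cast (factProd_pos _).ne'
  have hf' : ((x - 1).factorial : ℚ) ≠ 0 := by exact_mod_cast Nat.factorial_ne_zero _
  have hx0 : (x : ℚ) ≠ 0 := by exact_mod_cast (by omega : x ≠ 0)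
  push_cast
  field_simp

/-- Either `x = 0`, or `x - 1` is in `S` and gives the factor `1 - 1/1`. Hence the sum over movable
beads in the recurrence may run over all of `S`. -/
theorem mul_weight_eq_zero {S : Finset ℕ} {x : ℕ} (hxS : x ∈ S) (hx : x ∉ movable 1 S) :
    (x : ℚ) * weight S x = 0 := by
  rcases Nat.eq_zero_or_pos x with rfl | h0
  · simp
  have h1 : x - 1 ∈ S := by
    by_contra h
    exact hx (by simp [movable, hxS, h]; omega)
  rw [weight, prod_eq_zero (i := x - 1), mul_zero]
  · simp [h1]; omega
  · rw [Nat.cast_sub h0]; simp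

theorem sum_quot_move (S : Finset ℕ) :
    ∑ x ∈ movable 1 S, quot (move 1 S x) = excess S * quot S := by
  rw [sum_congr rfl fun x hx => quot_move hx, ← mul_sum, mul_comm, ← sum_mul_weight]
  congr 1
  exact sum_subset (filter_subset _ _) fun x hx h => mul_weight_eq_zero hx h

theorem excess_move {d : ℕ} {S : Finset ℕ} {x : ℕ} (hx : x ∈ movable d S) :
    excess (move d S x) = excess S - d := by
  obtain ⟨hxS, h1, h2⟩ : x ∈ S ∧ d ≤ x ∧ x - d ∉ S := by simpa [movable] using hx
  have h2' : x - d ∉ S.erase x := fun h => h2 (mem_of_mem_erase h)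
  have hS : excess S = excess (insert x (S.erase x)) := by rw [insert_erase hxS]
  rw [hS, move, excess_insert h2', excess_insert (notMem_erase x S)]
  push_cast [h1]
  ring

/-- Multiplying the recurrence by `(excess S - 1)!` writes `excess! * quot` as a sum of the same
quantities for smaller bead sets. When nothing is movable, `S` is an initial segment and the value
is `1`. -/
theorem excess_nonneg_and_integral (s : ℕ) : ∀ S : Finset ℕ, ∑ x ∈ S, x = s →
    0 ≤ excess S ∧ ∃ m : ℕ, ((excess S).toNat.factorial : ℚ) * quot S = m := by
  induction s using Nat.strong_induction_on with
  | _ s ih =>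
    intro S hs
    by_cases hm : (movable 1 S).Nonempty
    · have hpos : (0 : ℚ) < excess S * quot S := by
        rw [← sum_quot_move]; exact sum_pos (fun _ _ => quot_pos _) hm
      have hpos' : 0 < excess S := by
        have := pos_of_mul_pos_left hpos (quot_pos S).le
        exact_mod_cast this
      refine ⟨hpos'.le, ?_⟩
      have hex : ∀ x ∈ movable 1 S, ∃ m : ℕ,
          (((excess S).toNat - 1).factorial : ℚ) * quot (move 1 S x) = m := by
        intro x hx
        obtain ⟨hxS, h1, h2⟩ : x ∈ S ∧ 1 ≤ x ∧ x - 1 ∉ S := by simpa [movable] using hx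
        have hlt : ∑ y ∈ move 1 S x, y < s := by
          rw [move, sum_insert (fun h => h2 (mem_of_mem_erase h)), ← hs, ← add_sum_erase S _ hxS]
          omega
        obtain ⟨_, m, hm⟩ := ih _ hlt _ rfl
        refine ⟨m, ?_⟩
        rw [← hm, excess_move hx]
        congr 4
        omega
      choose! f hf using hex
      refine ⟨∑ x ∈ movable 1 S, f x, ?_⟩
      push_cast
      rw [← sum_congr rfl hf, ← mul_sum, sum_quot_move, ← mul_assoc]
      congr 1
      have h0 : (excess S).toNat ≠ 0 := by omega
      rw [← Nat.mul_factorial_pred h0, mul_comm]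
      push_cast
      congr 1
      have : ((excess S).toNat : ℤ) = excess S := Int.toNat_of_nonneg hpos'.le
      exact_mod_cast congrArg (Int.cast (R := ℚ)) this
    · have hS : S = range S.card := eq_range_of_closed fun x hx h0 => by
        by_contra h
        exact hm ⟨x, by simp [movable, hx, h]; omega⟩
      rw [hS, excess_range, quot_range]
      exact ⟨le_rfl, 1, by simp⟩

theorem excess_nonneg (S : Finset ℕ) : 0 ≤ excess S := (excess_nonneg_and_integral _ S rfl).1

theorem factProd_dvd (S : Finset ℕ) :
    factProd S ∣ (excess S).toNat.factorial * diffProd S := by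
  obtain ⟨m, hm⟩ := (excess_nonneg_and_integral _ S rfl).2
  have hf : (factProd S : ℚ) ≠ 0 := by exact_mod_cast (factProd_pos _).ne'
  refine ⟨m, ?_⟩
  rw [quot, ← mul_div_assoc, div_eq_iff hf] at hm
  rw [mul_comm (factProd S)]
  exact_mod_cast hm

end BetaSet

/-! ### Runners of the `p`-abacus and `p`-adic valuations -/

namespace BetaSet

open Finset

/-- The positions of the elements of `S` on runner `r` of the `p`-abacus. -/
def runner (p : ℕ) (S : Finset ℕ) (r : ℕ) : Finset ℕ := {x ∈ S | x % p = r}.image (· / p)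

/-- The sum of the sizes of the partitions on the runners of the `p`-abacus. -/
def quotExcess (p : ℕ) (S : Finset ℕ) : ℤ := ∑ r ∈ range p, excess (runner p S r)

/-- The `p`-adic valuation of `factProd S / diffProd S`. -/
def cost (p : ℕ) (S : Finset ℕ) : ℤ :=
  (padicValNat p (factProd S) : ℤ) - padicValNat p (diffProd S)

theorem runner_insert (p : ℕ) (S : Finset ℕ) (x r : ℕ) : runner p (insert x S) r =
    if x % p = r then insert (x / p) (runner p S r) else runner p S r := by
  unfold runner
  rw [filter_insert]
  split_ifs
  · rw [image_insert]
  · rfl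

theorem mem_runner {p r : ℕ} (hr : r < p) {S : Finset ℕ} {m : ℕ} :
    m ∈ runner p S r ↔ p * m + r ∈ S := by
  simp only [runner, mem_image, mem_filter]
  constructor
  · rintro ⟨x, ⟨hx, rfl⟩, rfl⟩
    rwa [Nat.div_add_mod]
  · intro h
    refine ⟨p * m + r, ⟨h, ?_⟩, ?_⟩
    · rw [Nat.mul_add_mod, Nat.mod_eq_of_lt hr]
    · rw [Nat.mul_add_div (by omega), Nat.div_eq_of_lt hr, add_zero]

theorem div_notMem_runner {p : ℕ} (hp : 0 < p) {S : Finset ℕ} {x : ℕ} (hx : x ∉ S) :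
    x / p ∉ runner p S (x % p) := by
  rwa [mem_runner (Nat.mod_lt x hp), Nat.div_add_mod]

theorem quotExcess_insert {p : ℕ} (hp : 0 < p) {S : Finset ℕ} {x : ℕ} (hx : x ∉ S) :
    quotExcess p (insert x S) =
      quotExcess p S + (x / p : ℕ) - (runner p S (x % p)).card := by
  have hm : x % p ∈ range p := mem_range.2 (Nat.mod_lt x hp)
  unfold quotExcess
  rw [← add_sum_erase _ _ hm, ← add_sum_erase (range p) _ hm, runner_insert, if_pos rfl,
    excess_insert (div_notMem_runner hp hx)]
  rw [sum_congr rfl fun r hr => ?_]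
  · ring
  · rw [runner_insert, if_neg (ne_of_mem_erase hr).symm]

theorem quotExcess_move {p : ℕ} (hp : 0 < p) {S : Finset ℕ} {x : ℕ} (hx : x ∈ movable p S) :
    quotExcess p (move p S x) = quotExcess p S - 1 := by
  obtain ⟨hxS, h1, h2⟩ : x ∈ S ∧ p ≤ x ∧ x - p ∉ S := by simpa [movable] using hx
  have h2' : x - p ∉ S.erase x := fun h => h2 (mem_of_mem_erase h)
  have hS : quotExcess p S = quotExcess p (insert x (S.erase x)) := by rw [insert_erase hxS]
  obtain ⟨y, rfl⟩ := Nat.exists_eq_add_of_le h1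
  rw [hS, move, quotExcess_insert hp h2', quotExcess_insert hp (notMem_erase _ S),
    Nat.add_sub_cancel_left, Nat.add_mod_left, Nat.add_div_left y hp]
  push_cast
  ring

/-- A bead with a free place just before it on its runner would be movable by `p`; so the runners of
a core are flush. -/
theorem runner_eq_range {p r : ℕ} (hr : r < p) {S : Finset ℕ} (hS : movable p S = ∅) :
    runner p S r = range (runner p S r).card := by
  refine eq_range_of_closed fun m hm h0 => ?_
  rw [mem_runner hr] at hm ⊢
  by_contra h
  have : p * m + r ∈ movable p S := by
    obtain ⟨k, rfl⟩ := Nat.exists_eq_succ_of_ne_zero h0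
    simp only [Nat.succ_eq_add_one, Nat.add_sub_cancel] at h hm ⊢
    simp only [movable, mem_filter]
    refine ⟨hm, by nlinarith, ?_⟩
    rwa [show p * (k + 1) + r - p = p * k + r by rw [mul_add]; omega]
  simp [hS] at this

theorem quotExcess_eq_zero {p : ℕ} {S : Finset ℕ} (hS : movable p S = ∅) :
    quotExcess p S = 0 :=
  sum_eq_zero fun r hr => by rw [runner_eq_range (mem_range.1 hr) hS, excess_range]

theorem cost_range (p k : ℕ) : cost p (range k) = 0 := by
  rw [cost, diffProd_range, sub_self]

theorem padicValNat_dist_of_mod_ne {p x y : ℕ} (h : y % p ≠ x % p) :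
    padicValNat p (Nat.dist x y) = 0 := by
  refine padicValNat.eq_zero_of_not_dvd fun hd => h ?_
  rcases le_total x y with hxy | hxy
  · rw [Nat.dist_eq_sub_of_le hxy] at hd
    exact ((Nat.modEq_iff_dvd' hxy).2 hd).symm
  · rw [Nat.dist_comm, Nat.dist_eq_sub_of_le hxy] at hd
    exact (Nat.modEq_iff_dvd' hxy).2 hd

/-! ### Valuations split along the runners. -/

section Prime

variable {p : ℕ} [hp : Fact p.Prime]

theorem padicValNat_prod_eq_sum {ι : Type*} {s : Finset ι} {f : ι → ℕ} (h : ∀ i ∈ s, f i ≠ 0) :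
    padicValNat p (∏ i ∈ s, f i) = ∑ i ∈ s, padicValNat p (f i) := by
  induction s using Finset.cons_induction with
  | empty => simp
  | cons i s hi ih =>
    rw [forall_mem_cons] at h
    rw [prod_cons, sum_cons, padicValNat.mul h.1 (prod_ne_zero_iff.2 h.2), ih h.2]

theorem cost_insert {S : Finset ℕ} {x : ℕ} (hx : x ∉ S) : cost p (insert x S) =
    cost p S + padicValNat p x.factorial - ∑ y ∈ S, (padicValNat p (Nat.dist x y) : ℤ) := by
  have hd : ∀ y ∈ S, Nat.dist x y ≠ 0 := fun y hy h =>
    hx (Nat.eq_of_dist_eq_zero h ▸ hy)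
  unfold cost
  rw [factProd_insert hx, diffProd_insert hx,
    padicValNat.mul (Nat.factorial_ne_zero _) (factProd_pos _).ne',
    padicValNat.mul (prod_ne_zero_iff.2 hd) (diffProd_pos _).ne', padicValNat_prod_eq_sum hd]
  push_cast
  ring

theorem padicValNat_factorial_eq (x : ℕ) :
    padicValNat p x.factorial = x / p + padicValNat p (x / p).factorial := by
  conv_lhs => rw [← Nat.div_add_mod x p]
  rw [padicValNat_factorial_mul_add _ (Nat.mod_lt _ hp.out.pos), padicValNat_factorial_mul,
    add_comm]

theorem padicValNat_dist_of_mod_eq {x y : ℕ} (h : y % p = x % p) (hxy : x ≠ y) :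
    padicValNat p (Nat.dist x y) = 1 + padicValNat p (Nat.dist (x / p) (y / p)) := by
  have hd : Nat.dist x y = p * Nat.dist (x / p) (y / p) := by
    conv_lhs => rw [← Nat.div_add_mod x p, ← Nat.div_add_mod y p, h]
    rw [Nat.dist_add_add_right, Nat.dist_mul_left]
  have h0 : Nat.dist (x / p) (y / p) ≠ 0 := by
    intro h0
    rw [h0, mul_zero] at hd
    exact hxy (Nat.eq_of_dist_eq_zero hd)
  rw [hd, padicValNat.mul hp.out.ne_zero h0, padicValNat.self hp.out.one_lt]

theorem sum_padicValNat_dist {S : Finset ℕ} {x : ℕ} (hx : x ∉ S) :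
    ∑ y ∈ S, (padicValNat p (Nat.dist x y) : ℤ) = (runner p S (x % p)).card +
      ∑ m ∈ runner p S (x % p), (padicValNat p (Nat.dist (x / p) m) : ℤ) := by
  have hinj : Set.InjOn (· / p) (({y ∈ S | y % p = x % p} : Finset ℕ) : Set ℕ) := by
    intro y hy z hz h
    simp only [coe_filter, Set.mem_ofPred_eq] at hy hz h
    rw [← Nat.div_add_mod y p, ← Nat.div_add_mod z p, hy.2, hz.2, h]
  unfold runner
  rw [sum_image hinj, card_image_of_injOn hinj, cast_card, ← sum_add_distrib, sum_filter]
  refine sum_congr rfl fun y hy => ?_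
  split_ifs with h
  · rw [padicValNat_dist_of_mod_eq h fun h => hx (h ▸ hy)]
    push_cast
    ring
  · rw [padicValNat_dist_of_mod_ne h, Nat.cast_zero]

/-- Insert beads one at a time. Legendre gives `x / p + v((x / p)!)` for `x!`, and every bead on the
runner of `x` gives `1 + v` of the difference of positions. The terms `x / p` minus the number of
those beads are exactly the growth of the runner's `excess`. -/
theorem cost_eq_sum_runner (S : Finset ℕ) :
    cost p S = ∑ r ∈ range p, (excess (runner p S r) + cost p (runner p S r)) := by
  induction S using Finset.induction_on with
  | empty => simp [cost, runner, diffProd, factProd, excess]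
  | insert x S hx ih =>
    have hm : x % p ∈ range p := mem_range.2 (Nat.mod_lt x hp.out.pos)
    have hd := div_notMem_runner hp.out.pos hx
    rw [← add_sum_erase _ _ hm] at ih
    rw [cost_insert hx, ih, sum_padicValNat_dist hx, padicValNat_factorial_eq,
      ← add_sum_erase _ _ hm, runner_insert, if_pos rfl, cost_insert hd, excess_insert hd]
    have hc : ∑ r ∈ (range p).erase (x % p),
        (excess (runner p (insert x S) r) + cost p (runner p (insert x S) r))
        = ∑ r ∈ (range p).erase (x % p), (excess (runner p S r) + cost p (runner p S r)) :=
      sum_congr rfl fun r hr => by rw [runner_insert, if_neg (ne_of_mem_erase hr).symm]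
    rw [hc]
    push_cast
    ring

theorem cost_le (S : Finset ℕ) : cost p S ≤ padicValNat p (excess S).toNat.factorial := by
  have h := (padicValNat_dvd_iff_le (p := p) (mul_ne_zero (Nat.factorial_ne_zero _)
    (diffProd_pos S).ne')).1 (pow_padicValNat_dvd.trans (factProd_dvd S))
  rw [padicValNat.mul (Nat.factorial_ne_zero _) (diffProd_pos S).ne'] at h
  unfold cost
  omega

/-- With `w_r` the size on runner `r`, the cost is at most `∑ (w_r + v(w_r!)) ≤ w + v(w!) =
v((wp)!)`, as `∏ w_r!` divides `(∑ w_r)!`. -/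
theorem cost_le_of_quotExcess {S : Finset ℕ} {w : ℕ} (h : quotExcess p S = w) :
    cost p S ≤ padicValNat p (w * p).factorial := by
  have hw : ∑ r ∈ range p, (excess (runner p S r)).toNat = w := by
    zify
    rw [← h, quotExcess]
    exact sum_congr rfl fun r _ => Int.toNat_of_nonneg (excess_nonneg _)
  have hle : ∑ r ∈ range p, padicValNat p (excess (runner p S r)).toNat.factorial
      ≤ padicValNat p w.factorial := by
    rw [← padicValNat_prod_eq_sum fun _ _ => Nat.factorial_ne_zero _]
    refine (padicValNat_dvd_iff_le (Nat.factorial_ne_zero _)).1 (pow_padicValNat_dvd.trans ?_)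
    rw [← hw]
    exact Nat.prod_factorial_dvd_factorial_sum _ _
  rw [mul_comm, padicValNat_factorial_mul, cost_eq_sum_runner, sum_add_distrib]
  have := sum_le_sum fun r (_ : r ∈ range p) => cost_le (p := p) (runner p S r)
  unfold quotExcess at h
  have hle' := Int.ofNat_le.2 hle
  rw [Nat.cast_sum] at hle'
  rw [Nat.cast_add]
  linarith

/-- This is the bead set of the one-row partition `(w)`: the differences to the top bead multiply to
`(m + w)! / w!`. -/
theorem cost_insert_add_range (m w : ℕ) :
    cost p (insert (m + w) (range m)) = padicValNat p w.factorial := by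
  have hx : m + w ∉ range m := by simp
  have h : ∏ y ∈ range m, Nat.dist (m + w) y = (m + w).descFactorial m := by
    rw [Nat.descFactorial_eq_prod_range]
    refine prod_congr rfl fun i hi => ?_
    rw [Nat.dist_comm, Nat.dist_eq_sub_of_le (by have := mem_range.1 hi; omega)]
  have h0 : (m + w).descFactorial m ≠ 0 := by
    rw [Ne, Nat.descFactorial_eq_zero_iff_lt]; omega
  rw [cost, factProd_insert hx, diffProd_insert hx, h, diffProd_range,
    padicValNat.mul (Nat.factorial_ne_zero _) (factProd_pos _).ne',
    padicValNat.mul h0 (factProd_pos _).ne',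
    ← Nat.factorial_mul_descFactorial (Nat.le_add_right m w),
    padicValNat.mul (Nat.factorial_ne_zero _) h0, Nat.add_sub_cancel_left]
  push_cast
  ring

theorem movable_erase_max {S : Finset ℕ} {x : ℕ} (hS : movable p S = ∅) (hx : ∀ y ∈ S, y ≤ x) :
    movable p (S.erase x) = ∅ := by
  refine filter_eq_empty_iff.2 fun y hy => ?_
  rintro ⟨h1, h2⟩
  have hy' := mem_of_mem_erase hy
  have hp0 := hp.out.pos
  have := filter_eq_empty_iff.1 hS hy'
  refine this ⟨h1, fun h => h2 (mem_erase.2 ⟨?_, h⟩)⟩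
  have := hx y hy'
  omega

theorem cost_insert_add_max {S : Finset ℕ} {x : ℕ} (hS : movable p S = ∅) (hxS : x ∈ S)
    (hx : ∀ y ∈ S, y ≤ x) (w : ℕ) :
    cost p (insert (x + w * p) (S.erase x)) = padicValNat p (w * p).factorial := by
  have hR := movable_erase_max hS hx
  have hlt := Nat.mod_lt x hp.out.pos
  have hm : x % p ∈ range p := mem_range.2 hlt
  rw [cost_eq_sum_runner, sum_eq_single_of_mem _ hm]
  · rw [runner_insert, Nat.add_mul_mod_self_right, if_pos rfl, runner_eq_range hlt hR,
      Nat.add_mul_div_right _ _ hp.out.pos]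
    have hnot : x / p ∉ range (runner p (S.erase x) (x % p)).card := by
      rw [← runner_eq_range hlt hR]
      exact div_notMem_runner hp.out.pos (notMem_erase x S)
    -- The runner of `x` in `S` is itself an initial segment, so the erased bead occupied the first
    -- place after the remaining ones.
    have hmem : x / p ∈ range ((runner p (S.erase x) (x % p)).card + 1) := by
      have h1 := runner_eq_range hlt hS
      have h2 : runner p S (x % p) = insert (x / p) (runner p (S.erase x) (x % p)) := by
        conv_lhs => rw [← insert_erase hxS, runner_insert, if_pos rfl]
      rw [← card_insert_of_notMem (div_notMem_runner hp.out.pos (notMem_erase x S)), ← h2, ← h1,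
        h2]
      exact mem_insert_self _ _
    have hk : (runner p (S.erase x) (x % p)).card = x / p := by
      simp only [mem_range] at hnot hmem
      omega
    rw [hk, excess_insert (by simp), cost_insert_add_range, excess_range, card_range, mul_comm w p,
      padicValNat_factorial_mul]
    push_cast
    ring
  · intro r hr hne
    rw [runner_insert, Nat.add_mul_mod_self_right, if_neg hne.symm,
      runner_eq_range (mem_range.1 hr) hR, excess_range, cost_range, add_zero]

end Prime

end BetaSet

/-! ### Lattice words and their number -/

namespace BetaSet

open Finset

/-- The beta set with `k` elements of the partition with parts `c 0, c 1, …`. -/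
def beta (k : ℕ) (c : ℕ → ℕ) : Finset ℕ := (range k).image fun i => c i + (k - 1 - i)

theorem beta_injOn (k : ℕ) {c : ℕ → ℕ} (hc : Antitone c) :
    Set.InjOn (fun i => c i + (k - 1 - i)) (range k : Set ℕ) := by
  have key : ∀ i j, i < j → j < k → c i + (k - 1 - i) ≠ c j + (k - 1 - j) := by
    intro i j hij hj
    have := hc hij.le
    omega
  intro i hi j hj h
  simp only [coe_range, Set.mem_Iio] at hi hj
  rcases lt_trichotomy i j with h' | h' | h'
  · exact absurd h (key i j h' hj)
  · exact h'
  · exact absurd h.symm (key j i h' hi)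

theorem card_beta (k : ℕ) {c : ℕ → ℕ} (hc : Antitone c) : (beta k c).card = k := by
  rw [beta, card_image_of_injOn (beta_injOn k hc), card_range]

theorem sum_beta (k : ℕ) {c : ℕ → ℕ} (hc : Antitone c) :
    ∑ x ∈ beta k c, x = ∑ i ∈ range k, c i + k.choose 2 := by
  rw [beta, sum_image (beta_injOn k hc), sum_add_distrib]
  congr 1
  rw [sum_range_reflect (fun i => i) k, sum_range_id, Nat.choose_two_right]

theorem excess_beta (k : ℕ) {c : ℕ → ℕ} (hc : Antitone c) :
    excess (beta k c) = ∑ i ∈ range k, c i := by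
  have h := sum_beta k hc
  rw [excess, card_beta k hc]
  zify at h
  push_cast
  rw [h]
  ring

theorem mem_beta {k : ℕ} {c : ℕ → ℕ} {x : ℕ} :
    x ∈ beta k c ↔ ∃ i < k, c i + (k - 1 - i) = x := by
  simp [beta]

/-- Subtract one from the part `c i`. -/
def decr (c : ℕ → ℕ) (i : ℕ) : ℕ → ℕ := Function.update c i (c i - 1)

theorem antitone_decr {c : ℕ → ℕ} (hc : Antitone c) {i : ℕ} (hi : c (i + 1) < c i) :
    Antitone (decr c i) := by
  refine antitone_nat_of_succ_le fun j => ?_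
  have := hc (Nat.le_succ j)
  unfold decr
  simp only [Function.update_apply]
  split_ifs with h1 h2 h2
  · omega
  · subst h1; simp only [Nat.succ_eq_add_one] at this; omega
  · subst h2; omega
  · exact this

/-- Beads that can step down by one correspond to rows ending in a removable box. For the last row
`i = k - 1` the comparison is with `c k = 0`. -/
theorem mem_movable_beta {k : ℕ} {c : ℕ → ℕ} (hc : Antitone c) (hk : ∀ i, k ≤ i → c i = 0)
    {i : ℕ} (hi : i < k) :
    c i + (k - 1 - i) ∈ movable 1 (beta k c) ↔ c (i + 1) < c i := by
  have hmem : c i + (k - 1 - i) ∈ beta k c := mem_beta.2 ⟨i, hi, rfl⟩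
  have hle := hc (Nat.le_succ i)
  simp only [Nat.succ_eq_add_one] at hle
  simp only [movable, mem_filter, hmem, true_and, mem_beta, not_exists, not_and]
  constructor
  · rintro ⟨h1, h2⟩
    by_contra h
    by_cases hik : i + 1 < k
    · exact h2 (i + 1) hik (by omega)
    · have := hk (i + 1) (by omega)
      omega
  · intro h
    refine ⟨by omega, fun j hj hj' => ?_⟩
    rcases Nat.lt_or_ge i j with hij | hij
    · have := hc (show i + 1 ≤ j from hij)
      omega
    · have := hc hij
      omega

theorem beta_decr {k : ℕ} {c : ℕ → ℕ} (hc : Antitone c) {i : ℕ} (hi : i < k)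
    (h : c (i + 1) < c i) :
    beta k (decr c i) = move 1 (beta k c) (c i + (k - 1 - i)) := by
  ext x
  simp only [move, mem_insert, mem_erase, mem_beta]
  constructor
  · rintro ⟨j, hj, rfl⟩
    by_cases hji : j = i
    · subst hji; left; simp [decr]; omega
    · right
      refine ⟨fun h => hji ?_, j, hj, by simp [decr, hji]⟩
      simp only [decr, Function.update_of_ne hji] at h
      exact beta_injOn k hc (by simpa using hj) (by simpa using hi) h
  · rintro (rfl | ⟨hx, j, hj, rfl⟩)
    · exact ⟨i, hi, by simp [decr]; omega⟩
    · refine ⟨j, hj, ?_⟩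
      have : j ≠ i := fun h => hx (by rw [h])
      simp [decr, this]

/-- The number of letters `i` among the first `m` letters of the word `r`. -/
def count {n : ℕ} (r : Fin n → ℕ) (m i : ℕ) : ℕ := #{x : Fin n | x.val < m ∧ r x = i}

/-- A word is a lattice word of content `c` if `i` occurs `c i` times, and in every initial
segment `i` occurs at least as often as `i + 1`. -/
def IsLattice {n : ℕ} (c : ℕ → ℕ) (r : Fin n → ℕ) : Prop :=
  (∀ i, count r n i = c i) ∧ ∀ m, Antitone (count r m)

theorem count_of_le {n : ℕ} (r : Fin n → ℕ) {m : ℕ} (hm : n ≤ m) (i : ℕ) :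
    count r m i = count r n i := by
  unfold count
  congr 1
  ext x
  simp [x.2.trans_le hm]

theorem count_snoc {n : ℕ} (r : Fin n → ℕ) (j m i : ℕ) :
    count (Fin.snoc r j : Fin (n + 1) → ℕ) m i =
      count r m i + if n < m ∧ j = i then 1 else 0 := by
  unfold count
  rw [card_filter, card_filter, Fin.sum_univ_castSucc]
  simp only [Fin.snoc_castSucc, Fin.snoc_last, Fin.val_castSucc, Fin.val_last]

/-- The last letter names the row of the box holding the largest entry, which must be removable.
Counts are constant once `m` reaches the word length, so the only new lattice condition is
antitonicity of `c` itself. -/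
theorem isLattice_snoc_iff {n : ℕ} {c : ℕ → ℕ} (hc : Antitone c) (r : Fin n → ℕ) (j : ℕ) :
    IsLattice c (Fin.snoc r j : Fin (n + 1) → ℕ) ↔ c (j + 1) < c j ∧ IsLattice (decr c j) r := by
  constructor
  · rintro ⟨h1, h2⟩
    have hcount : ∀ i, count r n i = decr c j i := by
      intro i
      have := h1 i
      rw [count_snoc, count_of_le r (Nat.le_succ n)] at this
      simp only [decr, Function.update_apply]
      by_cases hij : i = j
      · subst hij; simp at this ⊢; omega
      · rw [if_neg (by rintro ⟨_, rfl⟩; exact hij rfl)] at this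
        simpa [hij] using this
    have hanti : ∀ m ≤ n, Antitone (count r m) := by
      intro m hm i i' hii
      have := h2 m hii
      rw [count_snoc, count_snoc, if_neg (by omega), if_neg (by omega)] at this
      exact this
    refine ⟨?_, hcount, fun m => ?_⟩
    · have h3 := hanti n le_rfl (Nat.le_succ j)
      rw [hcount, hcount] at h3
      have h4 := h1 j
      rw [count_snoc, if_pos ⟨by omega, rfl⟩] at h4
      simp [decr] at h3
      omega
    · rcases le_total m n with h | h
      · exact hanti m h
      · intro i i' hii
        rw [count_of_le r h, count_of_le r h]
        exact hanti n le_rfl hii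
  · rintro ⟨hj, h1, h2⟩
    have hcount : ∀ m, n < m → ∀ i, count (Fin.snoc r j : Fin (n + 1) → ℕ) m i = c i := by
      intro m hm i
      rw [count_snoc, count_of_le r hm.le, h1]
      simp only [decr, Function.update_apply]
      by_cases hij : i = j
      · subst hij; simp [hm]; omega
      · rw [if_neg hij, if_neg (by rintro ⟨_, rfl⟩; exact hij rfl), add_zero]
    refine ⟨hcount _ (Nat.lt_succ_self n), fun m => ?_⟩
    rcases Nat.lt_or_ge n m with h | h
    · intro i i' hii
      rw [hcount m h, hcount m h]
      exact hc hii
    · intro i i' hii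
      rw [count_snoc, count_snoc, if_neg (by omega), if_neg (by omega)]
      exact h2 m hii

theorem IsLattice.lt {n k : ℕ} {c : ℕ → ℕ} (hk : ∀ i, k ≤ i → c i = 0) {r : Fin n → ℕ}
    (hr : IsLattice c r) (x : Fin n) : r x < k := by
  by_contra h
  have := (hr.1 (r x)).trans (hk _ (not_lt.1 h))
  rw [count, card_eq_zero, filter_eq_empty_iff] at this
  exact this (mem_univ x) ⟨x.2, rfl⟩

theorem finite_isLattice {n k : ℕ} {c : ℕ → ℕ} (hk : ∀ i, k ≤ i → c i = 0) :
    Finite {r : Fin n → ℕ // IsLattice c r} :=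
  Finite.of_injective (fun r (x : Fin n) => (⟨r.1 x, r.2.lt hk x⟩ : Fin k)) fun _ _ h =>
    Subtype.ext (funext fun x => congrArg Fin.val (congrFun h x))

/-- A nonempty lattice word is determined by its last letter and the word before it. -/
def latticeEquiv {n : ℕ} {c : ℕ → ℕ} (hc : Antitone c) {k : ℕ} (hk : ∀ i, k ≤ i → c i = 0) :
    {r : Fin (n + 1) → ℕ // IsLattice c r} ≃
      Σ i : {i // i ∈ (range k).filter fun i => c (i + 1) < c i},
        {r : Fin n → ℕ // IsLattice (decr c i) r} where
  toFun r :=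
    have h : c (r.1 (Fin.last n) + 1) < c (r.1 (Fin.last n)) ∧
        IsLattice (decr c (r.1 (Fin.last n))) (Fin.init r.1) := by
      rw [← isLattice_snoc_iff hc, Fin.snoc_init_self]
      exact r.2
    ⟨⟨r.1 (Fin.last n), mem_filter.2 ⟨mem_range.2 (r.2.lt hk _), h.1⟩⟩, ⟨Fin.init r.1, h.2⟩⟩
  invFun s := ⟨Fin.snoc s.2.1 s.1.1,
    (isLattice_snoc_iff hc _ _).2 ⟨(mem_filter.1 s.1.2).2, s.2.2⟩⟩
  left_inv _ := Subtype.ext (Fin.snoc_init_self _)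
  right_inv := by
    rintro ⟨⟨i, hi⟩, ⟨r, hr⟩⟩
    have h1 : (Fin.snoc r i : Fin (n + 1) → ℕ) (Fin.last n) = i := Fin.snoc_last _ _
    have h2 : Fin.init (Fin.snoc r i : Fin (n + 1) → ℕ) = r := Fin.init_snoc _ _
    exact Sigma.subtype_ext (Subtype.ext h1) h2

/-- Deleting the last letter gives the branching recurrence for the number of words, and
`sum_quot_move` is the same recurrence for the right side. -/
theorem card_isLattice {k : ℕ} (n : ℕ) : ∀ c : ℕ → ℕ, Antitone c → (∀ i, k ≤ i → c i = 0) →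
    ∑ i ∈ range k, c i = n →
    (Nat.card {r : Fin n → ℕ // IsLattice c r} : ℚ) = n.factorial * quot (beta k c) := by
  induction n with
  | zero =>
    intro c hc hk hs
    have hc0 : ∀ i, c i = 0 := fun i => by
      rcases Nat.lt_or_ge i k with h | h
      · exact (sum_eq_zero_iff.1 hs) i (mem_range.2 h)
      · exact hk i h
    have hb : beta k c = range k := by
      simp only [beta, hc0, zero_add]
      exact range_image_pred_top_sub k
    have hl : ∀ r : Fin 0 → ℕ, IsLattice c r := fun r =>
      ⟨fun i => by simp [count, hc0], fun m i j _ => by simp [count]⟩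
    have : Unique {r : Fin 0 → ℕ // IsLattice c r} :=
      { default := ⟨Fin.elim0, hl _⟩, uniq := fun r => Subtype.ext (Subsingleton.elim _ _) }
    rw [hb, quot_range, Nat.card_unique]
    simp
  | succ n ih =>
    intro c hc hk hs
    have hkd : ∀ j, c (j + 1) < c j → ∀ i, k ≤ i → decr c j i = 0 := by
      intro j hj i hi
      simp only [decr, Function.update_apply]
      split_ifs with h
      · have := hk i hi; subst h; omega
      · exact hk i hi
    have hsum : ∀ i ∈ (range k).filter fun i => c (i + 1) < c i,
        (Nat.card {r : Fin n → ℕ // IsLattice (decr c i) r} : ℚ) =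
          n.factorial * quot (move 1 (beta k c) (c i + (k - 1 - i))) := by
      intro i hi
      obtain ⟨hik, hi⟩ := mem_filter.1 hi
      rw [ih (decr c i) (antitone_decr hc hi) (hkd i hi), beta_decr hc (mem_range.1 hik) hi]
      rw [← add_sum_erase _ _ hik] at hs ⊢
      rw [sum_congr (g := fun j => c j) rfl fun j hj => by simp [decr, ne_of_mem_erase hj]]
      simp [decr]
      omega
    have hfin : ∀ i : {i // i ∈ (range k).filter fun i => c (i + 1) < c i},
        Finite {r : Fin n → ℕ // IsLattice (decr c i) r} :=
      fun i => finite_isLattice (hkd i (mem_filter.1 i.2).2)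
    have himage : movable 1 (beta k c) =
        ((range k).filter fun i => c (i + 1) < c i).image fun i => c i + (k - 1 - i) := by
      ext x
      simp only [mem_image, mem_filter, mem_range]
      constructor
      · intro hx
        obtain ⟨i, hi, rfl⟩ := mem_beta.1 (mem_filter.1 hx).1
        exact ⟨i, ⟨hi, (mem_movable_beta hc hk hi).1 hx⟩, rfl⟩
      · rintro ⟨i, ⟨hi, h⟩, rfl⟩
        exact (mem_movable_beta hc hk hi).2 h
    have hinj := (beta_injOn k hc).mono
      (coe_subset.2 (filter_subset (fun i => c (i + 1) < c i) (range k)))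
    rw [Nat.card_congr (latticeEquiv hc hk), Nat.card_sigma, Nat.cast_sum,
      univ_eq_attach,
      sum_attach _ fun i => (Nat.card {r : Fin n → ℕ // IsLattice (decr c i) r} : ℚ),
      sum_congr rfl hsum, ← mul_sum,
      ← sum_image (f := fun x => quot (move 1 (beta k c) x)) hinj, ← himage, sum_quot_move,
      excess_beta k hc, hs, Nat.factorial_succ]
    push_cast
    ring

end BetaSet

/-! ### The dimension of a Specht module -/

namespace YoungDiagram

open Finset BetaSet

variable {μ : YoungDiagram}

theorem mem_cells_of_tableau (t : μ.Tableau) (x : Fin μ.card) : (t.rowOf x, t.colOf x) ∈ μ :=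
  (t.symm x).2

theorem Tableau.ext_entry (t : μ.Tableau) {x y : Fin μ.card} (hr : t.rowOf x = t.rowOf y)
    (hc : t.colOf x = t.colOf y) : x = y :=
  t.symm.injective (Subtype.ext (Prod.ext hr hc))

theorem Tableau.rowOf_permute (t : μ.Tableau) (g : Equiv.Perm (Fin μ.card)) (x : Fin μ.card) :
    (t.permute g).rowOf x = t.rowOf (g⁻¹ x) := rfl

theorem Tableau.colOf_inv (t : μ.Tableau) {g : Equiv.Perm (Fin μ.card)}
    (hg : g ∈ t.colStabilizer) (x : Fin μ.card) : t.colOf (g⁻¹ x) = t.colOf x :=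
  t.colStabilizer.inv_mem hg x

theorem Tableau.swap_mem_colStabilizer (t : μ.Tableau) {x y : Fin μ.card}
    (h : t.colOf x = t.colOf y) : Equiv.swap x y ∈ t.colStabilizer := by
  intro z
  by_cases hx : z = x
  · subst hx; rw [Equiv.swap_apply_left, h]
  · by_cases hy : z = y
    · subst hy; rw [Equiv.swap_apply_right, h]
    · rw [Equiv.swap_apply_of_ne_of_ne hx hy]

/-- The row function of a tabloid: it maps each entry to its row. -/
def Tabloid.rowFn : μ.Tabloid → Fin μ.card → ℕ :=
  Quotient.lift (fun t : μ.Tableau => t.rowOf) fun _ _ h => funext h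

theorem Tabloid.rowFn_tabloid (t : μ.Tableau) : t.tabloid.rowFn = t.rowOf := rfl

theorem Tabloid.rowFn_injective : Function.Injective (Tabloid.rowFn (μ := μ)) := by
  rintro ⟨s⟩ ⟨t⟩ h
  exact Quotient.sound fun x => congrFun h x

theorem Tabloid.exists_rep (T : μ.Tabloid) : ∃ t : μ.Tableau, t.tabloid = T :=
  Quotient.exists_rep T

noncomputable instance : Fintype μ.Tabloid := by
  have : Finite μ.Tabloid := Quotient.finite _
  exact Fintype.ofFinite _

theorem Tabloid.count_rowFn (T : μ.Tabloid) (i : ℕ) : count T.rowFn μ.card i = μ.rowLen i := by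
  obtain ⟨t, rfl⟩ := T.exists_rep
  rw [rowLen_eq_card, count]
  refine card_bij (fun x _ => (t.symm x).1) ?_ ?_ ?_
  · intro x hx
    exact mem_row_iff.2 ⟨(t.symm x).2, (mem_filter.1 hx).2.2⟩
  · intro x _ y _ h
    exact t.symm.injective (Subtype.ext h)
  · intro c hc
    obtain ⟨h1, h2⟩ := mem_row_iff.1 hc
    refine ⟨t ⟨c, h1⟩, mem_filter.2 ⟨mem_univ _, Fin.is_lt _, ?_⟩, by simp⟩
    rw [Tabloid.rowFn_tabloid, Tableau.rowOf, Equiv.symm_apply_apply, h2]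

/-- The action of a permutation of the entries on tabloids. -/
def Tabloid.permute (g : Equiv.Perm (Fin μ.card)) : μ.Tabloid → μ.Tabloid :=
  Quotient.map (fun t => t.permute g) fun _ _ h x => h (g⁻¹ x)

theorem Tabloid.rowFn_permute (g : Equiv.Perm (Fin μ.card)) (T : μ.Tabloid) (x : Fin μ.card) :
    (T.permute g).rowFn x = T.rowFn (g⁻¹ x) := by
  obtain ⟨t, rfl⟩ := T.exists_rep
  rfl

theorem Tabloid.permute_permute (g h : Equiv.Perm (Fin μ.card)) (T : μ.Tabloid) :
    (T.permute h).permute g = T.permute (g * h) :=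
  Tabloid.rowFn_injective (funext fun x => by simp [Tabloid.rowFn_permute])

theorem Tabloid.permute_one (T : μ.Tabloid) : T.permute 1 = T :=
  Tabloid.rowFn_injective (funext fun x => by simp [Tabloid.rowFn_permute])

theorem Tabloid.permute_injective (g : Equiv.Perm (Fin μ.card)) :
    Function.Injective (Tabloid.permute (μ := μ) g) := fun S T h => by
  rw [← S.permute_one, ← T.permute_one, ← inv_mul_cancel g, ← Tabloid.permute_permute, h,
    Tabloid.permute_permute]

section Ring

variable {R : Type*} [CommRing R]

open Classical in
theorem Tableau.polytabloid_apply (t : μ.Tableau) (T : μ.Tabloid) : t.polytabloid R T =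
    ∑ g : t.colStabilizer, if (t.permute g.1).tabloid = T then
      (((Equiv.Perm.sign g.1 : ℤˣ) : ℤ) : R) else 0 := by
  rw [Tableau.polytabloid, Finsupp.finsetSum_apply]
  simp only [Finsupp.single_apply]

theorem Tableau.exists_of_polytabloid_apply_ne_zero {t : μ.Tableau} {T : μ.Tabloid}
    (h : t.polytabloid R T ≠ 0) : ∃ g ∈ t.colStabilizer, (t.permute g).tabloid = T := by
  classical
  rw [Tableau.polytabloid_apply] at h
  obtain ⟨g, _, hg⟩ := exists_ne_zero_of_sum_ne_zero h
  exact ⟨g.1, g.2, by by_contra h'; exact hg (if_neg h')⟩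

theorem Tableau.polytabloid_permute_swap {t : μ.Tableau} {x y : Fin μ.card}
    (h : t.colOf x = t.colOf y) (hxy : x ≠ y) (T : μ.Tabloid) :
    t.polytabloid R (T.permute (Equiv.swap x y)) = -t.polytabloid R T := by
  classical
  rw [Tableau.polytabloid_apply, Tableau.polytabloid_apply, ← sum_neg_distrib]
  let τ : t.colStabilizer := ⟨Equiv.swap x y, t.swap_mem_colStabilizer h⟩
  rw [← Equiv.sum_comp (Equiv.mulLeft τ)]
  refine sum_congr rfl fun g _ => ?_
  have h1 : (t.permute (Equiv.mulLeft τ g).1).tabloid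
      = (t.permute g.1).tabloid.permute (Equiv.swap x y) := rfl
  have h2 : Equiv.Perm.sign (Equiv.mulLeft τ g).1 = -Equiv.Perm.sign g.1 := by
    simp [τ, Equiv.Perm.sign_swap hxy]
  rw [h1, h2]
  simp only [(Tabloid.permute_injective _).eq_iff]
  split_ifs <;> simp

/-- Column permutations keep the entries of a column in distinct rows. Antisymmetry alone would not
give this vanishing in characteristic two. -/
theorem Tableau.polytabloid_apply_of_fixed {t : μ.Tableau} {x y : Fin μ.card}
    (h : t.colOf x = t.colOf y) (hxy : x ≠ y) {T : μ.Tabloid} (hT : T.rowFn x = T.rowFn y) :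
    t.polytabloid R T = 0 := by
  by_contra h0
  obtain ⟨g, hg, rfl⟩ := Tableau.exists_of_polytabloid_apply_ne_zero h0
  refine hxy (g⁻¹.injective (t.ext_entry hT ?_))
  rw [t.colOf_inv hg, t.colOf_inv hg, h]

/-! ### Garnir-type relations and the upper bound for the dimension. -/

open Classical in
/-- The tabloids that agree with `r` outside `Z` and have `Z` within the rows `i` and `i + 1`. -/
noncomputable def garnirSet (r : Fin μ.card → ℕ) (Z : Finset (Fin μ.card)) (i : ℕ) :
    Finset μ.Tabloid :=
  {T | (∀ x ∉ Z, T.rowFn x = r x) ∧ ∀ x ∈ Z, T.rowFn x = i ∨ T.rowFn x = i + 1}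

theorem mem_garnirSet {r : Fin μ.card → ℕ} {Z : Finset (Fin μ.card)} {i : ℕ} {T : μ.Tabloid} :
    T ∈ garnirSet r Z i ↔
      (∀ x ∉ Z, T.rowFn x = r x) ∧ ∀ x ∈ Z, T.rowFn x = i ∨ T.rowFn x = i + 1 := by
  simp [garnirSet]

theorem permute_swap_mem_garnirSet {r : Fin μ.card → ℕ} {Z : Finset (Fin μ.card)} {i : ℕ}
    {T : μ.Tabloid} (hT : T ∈ garnirSet r Z i) {x y : Fin μ.card} (hx : x ∈ Z) (hy : y ∈ Z) :
    T.permute (Equiv.swap x y) ∈ garnirSet r Z i := by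
  rw [mem_garnirSet] at hT ⊢
  refine ⟨fun z hz => ?_, fun z hz => ?_⟩
  · rw [Tabloid.rowFn_permute, Equiv.swap_inv,
      Equiv.swap_apply_of_ne_of_ne (ne_of_mem_of_not_mem hx hz).symm
        (ne_of_mem_of_not_mem hy hz).symm]
    exact hT.1 z hz
  · rw [Tabloid.rowFn_permute, Equiv.swap_inv]
    refine hT.2 _ ?_
    rw [Equiv.swap_apply_def]
    split_ifs <;> assumption

/-- If two entries of `Z` share a column of `t`, swapping them cancels the terms in pairs. Otherwise
`Z` meets more than `μ.rowLen i` columns, so some entry lies in a column that reaches neither row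
`i` nor row `i + 1`, and every term is zero. -/
theorem sum_garnirSet_polytabloid (t : μ.Tableau) (r : Fin μ.card → ℕ) {Z : Finset (Fin μ.card)}
    {i : ℕ} (hZ : μ.rowLen i < #Z) : ∑ T ∈ garnirSet r Z i, t.polytabloid R T = 0 := by
  by_cases hinj : ∃ x ∈ Z, ∃ y ∈ Z, x ≠ y ∧ t.colOf x = t.colOf y
  · obtain ⟨x, hx, y, hy, hxy, hcol⟩ := hinj
    refine sum_involution (fun T _ => T.permute (Equiv.swap x y)) ?_ ?_ ?_ ?_
    · intro T _
      rw [Tableau.polytabloid_permute_swap hcol hxy, add_neg_cancel]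
    · intro T _ h0 hT
      refine h0 (Tableau.polytabloid_apply_of_fixed hcol hxy ?_)
      conv_lhs => rw [← hT, Tabloid.rowFn_permute, Equiv.swap_inv, Equiv.swap_apply_left]
    · intro T hT
      exact permute_swap_mem_garnirSet hT hx hy
    · intro T _
      rw [Tabloid.permute_permute, Equiv.swap_mul_self, Tabloid.permute_one]
  · obtain ⟨z, hz, hcol⟩ : ∃ z ∈ Z, μ.rowLen i ≤ t.colOf z := by
      by_contra! h
      have hmaps : Set.MapsTo t.colOf (Z : Set (Fin μ.card)) (range (μ.rowLen i)) :=
        fun z hz => by simpa using h z hz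
      rw [← card_range (μ.rowLen i)] at hZ
      obtain ⟨x, hx, y, hy, hne, heq⟩ := exists_ne_map_eq_of_card_lt_of_maps_to hZ hmaps
      exact hinj ⟨x, hx, y, hy, hne, heq⟩
    refine sum_eq_zero fun T hT => ?_
    by_contra h0
    obtain ⟨g, hg, rfl⟩ := Tableau.exists_of_polytabloid_apply_ne_zero h0
    have h1 := mem_iff_lt_rowLen.1 (mem_cells_of_tableau t (g⁻¹ z))
    rw [t.colOf_inv hg] at h1
    have h2 := μ.rowLen_anti i (i + 1) (Nat.le_succ i)
    rcases (mem_garnirSet.1 hT).2 z hz with h | h <;>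
    · rw [Tabloid.rowFn_tabloid, Tableau.rowOf_permute] at h
      rw [h] at h1
      omega

theorem sum_garnirSet {v : YoungModule R μ} (hv : v ∈ μ.spechtModule R) (r : Fin μ.card → ℕ)
    {Z : Finset (Fin μ.card)} {i : ℕ} (hZ : μ.rowLen i < #Z) :
    ∑ T ∈ garnirSet r Z i, v T = 0 := by
  induction hv using Submodule.span_induction with
  | mem v hv =>
    obtain ⟨t, rfl⟩ := hv
    exact sum_garnirSet_polytabloid t r hZ
  | zero => simp
  | add v w _ _ hv hw => simp [sum_add_distrib, hv, hw]
  | smul a v _ hv => simp [← mul_sum, hv]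

theorem toColex_lt_of_mem_garnirSet {S T : μ.Tabloid} {m i : ℕ} {Z : Finset (Fin μ.card)}
    (hZ : ∀ x ∈ Z, x.val < m ∧ T.rowFn x = i + 1 ∨ m ≤ x.val ∧ T.rowFn x = i)
    (hS : S ∈ garnirSet T.rowFn Z i) (hne : S ≠ T) : toColex T.rowFn < toColex S.rowFn := by
  classical
  rw [mem_garnirSet] at hS
  have hex : ({x | S.rowFn x ≠ T.rowFn x} : Finset (Fin μ.card)).Nonempty := by
    by_contra h
    rw [not_nonempty_iff_eq_empty, filter_eq_empty_iff] at h
    exact hne (Tabloid.rowFn_injective (funext fun x => not_not.1 (h (mem_univ x))))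
  obtain ⟨x, hx, hmax⟩ := exists_max_image _ id hex
  rw [mem_filter] at hx
  have hafter : ∀ y, x < y → T.rowFn y = S.rowFn y := by
    intro y hy
    by_contra h
    exact absurd (hmax y (mem_filter.2 ⟨mem_univ y, fun h' => h h'.symm⟩)) (not_le.2 hy)
  have hxZ : x ∈ Z := by
    by_contra h
    exact hx.2 (hS.1 x h)
  refine ⟨x, hafter, ?_⟩
  rcases hZ x hxZ with ⟨hxm, hTx⟩ | ⟨hxm, hTx⟩
  · exfalso
    have hSx : S.rowFn x = i := (hS.2 x hxZ).resolve_right fun h => hx.2 (h.trans hTx.symm)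
    -- If the last difference came before `m`, `S` would keep every `i` of `T` and gain one at `x`,
    -- against the fixed row length.
    have hsub : ({y | y.val < μ.card ∧ T.rowFn y = i} : Finset (Fin μ.card)) ⊂
        ({y | y.val < μ.card ∧ S.rowFn y = i} : Finset (Fin μ.card)) := by
      refine (ssubset_iff_of_subset fun y hy => ?_).2 ⟨x, ?_, ?_⟩
      · obtain ⟨_, hy1, hy⟩ := mem_filter.1 hy
        refine mem_filter.2 ⟨mem_univ y, hy1, ?_⟩
        by_cases hyZ : y ∈ Z
        · rcases hZ y hyZ with ⟨_, h⟩ | ⟨h, _⟩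
          · omega
          · rw [← hafter y (Fin.lt_def.2 (lt_of_lt_of_le hxm h)), hy]
        · rw [hS.1 y hyZ, hy]
      · simp [hSx]
      · simp [hTx]
    have := card_lt_card hsub
    have h1 := T.count_rowFn i
    have h2 := S.count_rowFn i
    unfold count at h1 h2
    omega
  · have hSx : S.rowFn x = i + 1 := (hS.2 x hxZ).resolve_left fun h => hx.2 (h.trans hTx.symm)
    change T.rowFn x < S.rowFn x
    omega

/-- Take the colex-largest tabloid `T` in the support of `v`. If it is not lattice, a suitable
relation contains `T` and otherwise only colex-larger tabloids, forcing `v T = 0`. -/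
theorem eq_zero_of_forall_isLattice {v : YoungModule R μ} (hv : v ∈ μ.spechtModule R)
    (h : ∀ T : μ.Tabloid, IsLattice μ.rowLen T.rowFn → v T = 0) : v = 0 := by
  classical
  by_contra hv0
  have hne : ({T | v T ≠ 0} : Finset μ.Tabloid).Nonempty := by
    by_contra h'
    rw [not_nonempty_iff_eq_empty, filter_eq_empty_iff] at h'
    exact hv0 (Finsupp.ext fun T => not_not.1 (h' (mem_univ T)))
  obtain ⟨T, hT, hmax⟩ := exists_max_image _ (fun T : μ.Tabloid => toColex T.rowFn) hne
  rw [mem_filter] at hT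
  have hnl : ¬ ∀ m, Antitone (count T.rowFn m) := fun h' => hT.2 (h T ⟨T.count_rowFn, h'⟩)
  obtain ⟨m, hm⟩ := not_forall.1 hnl
  obtain ⟨i, hi⟩ : ∃ i, count T.rowFn m i < count T.rowFn m (i + 1) := by
    by_contra! h'
    exact hm (antitone_nat_of_succ_le h')
  -- The lattice condition fails at `m`, `i`: the entries `i + 1` before `m` outnumber the entries
  -- `i` there, so together with the later entries `i` they exceed the length of row `i`.
  let A : Finset (Fin μ.card) := {x | m ≤ x.val ∧ T.rowFn x = i}
  let B : Finset (Fin μ.card) := {x | x.val < m ∧ T.rowFn x = i + 1}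
  have hdisj : Disjoint B A := by
    rw [disjoint_left]
    intro x hx hx'
    simp only [A, B, mem_filter] at hx hx'
    omega
  have hZ : ∀ x ∈ B ∪ A, x.val < m ∧ T.rowFn x = i + 1 ∨ m ≤ x.val ∧ T.rowFn x = i := by
    intro x hx
    simpa [A, B] using hx
  have hA : count T.rowFn m i + #A = μ.rowLen i := by
    rw [← T.count_rowFn i, count, count, ← card_union_of_disjoint]
    · congr 1
      ext x
      have := x.2
      simp only [A, mem_union, mem_filter, mem_univ, true_and]
      omega
    · rw [disjoint_left]
      intro x hx hx'
      simp only [A, mem_filter] at hx hx'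
      omega
  have hcard : μ.rowLen i < #(B ∪ A) := by
    rw [card_union_of_disjoint hdisj]
    change _ < count T.rowFn m (i + 1) + _
    omega
  have hmem : T ∈ garnirSet T.rowFn (B ∪ A) i :=
    mem_garnirSet.2 ⟨fun _ _ => rfl, fun x hx => by have := hZ x hx; omega⟩
  have hsum := sum_garnirSet hv T.rowFn hcard
  rw [sum_eq_single_of_mem T hmem] at hsum
  · exact hT.2 hsum
  · intro S hS hne
    by_contra h0
    exact absurd (hmax S (mem_filter.2 ⟨mem_univ S, h0⟩))
      (not_le.2 (toColex_lt_of_mem_garnirSet hZ hS hne))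

end Ring

/-! #### Standard tableaux of lattice words -/

theorem count_lt_count {n : ℕ} (r : Fin n → ℕ) {m : ℕ} {x : Fin n} (h : x.val < m) :
    count r x.val (r x) < count r m (r x) := by
  refine card_lt_card ((ssubset_iff_of_subset fun y hy => ?_).2 ⟨x, ?_, ?_⟩)
  · simp only [mem_filter] at hy ⊢
    exact ⟨hy.1, hy.2.1.trans h, hy.2.2⟩
  · simp [h]
  · simp

/-- The position of the entry `x` in the standard tableau of the lattice word `r`. -/
def latticeCell {r : Fin μ.card → ℕ} (hr : IsLattice μ.rowLen r) (x : Fin μ.card) :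
    {c : ℕ × ℕ // c ∈ μ.cells} :=
  ⟨(r x, count r x.val (r x)), by
    rw [mem_cells, mem_iff_lt_rowLen, ← hr.1]
    exact count_lt_count r x.2⟩

theorem latticeCell_bijective {r : Fin μ.card → ℕ} (hr : IsLattice μ.rowLen r) :
    Function.Bijective (latticeCell hr) := by
  rw [Fintype.bijective_iff_injective_and_card]
  refine ⟨fun x y h => ?_, by simp⟩
  have h' := Prod.ext_iff.1 (Subtype.ext_iff.1 h)
  obtain ⟨h1, h2⟩ : r x = r y ∧ count r x.val (r x) = count r y.val (r y) := h'
  rcases lt_trichotomy x y with hxy | hxy | hxy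
  · have := count_lt_count r (x := x) (m := y.val) hxy
    rw [h2, h1] at this
    exact absurd this (lt_irrefl _)
  · exact hxy
  · have := count_lt_count r (x := y) (m := x.val) hxy
    rw [← h2, h1] at this
    exact absurd this (lt_irrefl _)

/-- The standard tableau of a lattice word. -/
noncomputable def latticeTableau {r : Fin μ.card → ℕ} (hr : IsLattice μ.rowLen r) : μ.Tableau :=
  (Equiv.ofBijective _ (latticeCell_bijective hr)).symm

theorem colOf_latticeTableau {r : Fin μ.card → ℕ} (hr : IsLattice μ.rowLen r) (x : Fin μ.card) :
    (latticeTableau hr).colOf x = count r x.val (r x) := rfl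

theorem latticeTableau_col_lt {r : Fin μ.card → ℕ} (hr : IsLattice μ.rowLen r)
    {x y : Fin μ.card} (hcol : (latticeTableau hr).colOf x = (latticeTableau hr).colOf y)
    (hxy : x < y) : r x < r y := by
  rw [colOf_latticeTableau, colOf_latticeTableau] at hcol
  by_contra! h
  have h1 := hr.2 y.val h
  have h2 := count_lt_count r (x := x) (m := y.val) hxy
  omega

/-- At the largest moved entry `x`, the row becomes that of the smaller entry `g⁻¹ x` of the same
column, which lies higher up. So the standard tabloid is the leading term of its polytabloid. -/
theorem toColex_permute_lt {r : Fin μ.card → ℕ} (hr : IsLattice μ.rowLen r)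
    {g : Equiv.Perm (Fin μ.card)} (hg : g ∈ (latticeTableau hr).colStabilizer) (h1 : g ≠ 1) :
    toColex ((latticeTableau hr).permute g).tabloid.rowFn < toColex r := by
  have hex : ({x | g⁻¹ x ≠ x} : Finset (Fin μ.card)).Nonempty := by
    by_contra h
    rw [not_nonempty_iff_eq_empty, filter_eq_empty_iff] at h
    exact h1 (inv_eq_one.1 (Equiv.ext fun x => not_not.1 (h (mem_univ x))))
  obtain ⟨x, hx, hmax⟩ := exists_max_image _ id hex
  rw [mem_filter] at hx
  have hlt : g⁻¹ x < x := by
    refine lt_of_le_of_ne (hmax _ (mem_filter.2 ⟨mem_univ _, fun h => hx.2 ?_⟩)) hx.2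
    exact g⁻¹.injective h
  refine ⟨x, fun y hy => ?_, ?_⟩
  · have : g⁻¹ y = y := by
      by_contra h
      exact absurd (hmax y (mem_filter.2 ⟨mem_univ y, h⟩)) (not_le.2 hy)
    change r (g⁻¹ y) = r y
    rw [this]
  · exact latticeTableau_col_lt hr (Tableau.colOf_inv _ hg x) hlt

section Field

variable (F : Type*) [Field F]

theorem polytabloid_latticeTableau_self {r : Fin μ.card → ℕ} (hr : IsLattice μ.rowLen r) :
    (latticeTableau hr).polytabloid F (latticeTableau hr).tabloid = 1 := by
  classical
  rw [Tableau.polytabloid_apply, sum_eq_single_of_mem 1 (mem_univ _)]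
  · have h1 : ((latticeTableau hr).permute 1).tabloid = (latticeTableau hr).tabloid := rfl
    rw [OneMemClass.coe_one, if_pos h1, Equiv.Perm.sign_one, Units.val_one, Int.cast_one]
  · intro g _ hg
    refine if_neg fun h => ?_
    have := toColex_permute_lt hr g.2 fun h => hg (Subtype.ext h)
    rw [h] at this
    exact absurd this (lt_irrefl _)

theorem polytabloid_latticeTableau_of_lt {r : Fin μ.card → ℕ} (hr : IsLattice μ.rowLen r)
    {T : μ.Tabloid} (h : toColex r < toColex T.rowFn) :
    (latticeTableau hr).polytabloid F T = 0 := by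
  by_contra h0
  obtain ⟨g, hg, rfl⟩ := Tableau.exists_of_polytabloid_apply_ne_zero h0
  by_cases h1 : g = 1
  · subst h1
    exact absurd h (lt_irrefl _)
  · exact absurd h (toColex_permute_lt hr hg h1).not_gt

theorem linearIndependent_polytabloid (μ : YoungDiagram) :
    LinearIndependent F fun r : {r : Fin μ.card → ℕ // IsLattice μ.rowLen r} =>
      (latticeTableau r.2).polytabloid F := by
  classical
  rw [linearIndependent_iff']
  intro s c hsum
  by_contra! hc
  obtain ⟨r₀, hr₀, hc₀⟩ := hc
  have hne : (s.filter fun r => c r ≠ 0).Nonempty := ⟨r₀, mem_filter.2 ⟨hr₀, hc₀⟩⟩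
  obtain ⟨r, hr, hmax⟩ := exists_max_image _ (fun r => toColex r.1) hne
  obtain ⟨hrs, hr0⟩ := mem_filter.1 hr
  have := DFunLike.congr_fun hsum (latticeTableau r.2).tabloid
  rw [Finsupp.finsetSum_apply, sum_eq_single_of_mem r hrs] at this
  · rw [Finsupp.smul_apply, polytabloid_latticeTableau_self, smul_eq_mul, mul_one] at this
    exact hr0 this
  · intro r' hr' hne'
    rw [Finsupp.smul_apply]
    by_cases h0 : c r' = 0
    · rw [h0, zero_smul]
    · rw [polytabloid_latticeTableau_of_lt, smul_zero]
      exact lt_of_le_of_ne (hmax r' (mem_filter.2 ⟨hr', h0⟩)) fun h => hne' (Subtype.ext h)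

/-- Evaluation at the lattice tabloids is injective on the Specht module, which bounds the dimension
above; the independent standard polytabloids bound it below. -/
theorem finrank_spechtModule (μ : YoungDiagram) :
    Module.finrank F (μ.spechtModule F) =
      Nat.card {r : Fin μ.card → ℕ // IsLattice μ.rowLen r} := by
  have hk : ∀ i, μ.colLen 0 ≤ i → μ.rowLen i = 0 := by
    intro i hi
    by_contra h
    have := mem_iff_lt_colLen.1 (mem_iff_lt_rowLen.2 (Nat.pos_of_ne_zero h))
    omega
  have := finite_isLattice (n := μ.card) hk
  have := Fintype.ofFinite {r : Fin μ.card → ℕ // IsLattice μ.rowLen r}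
  rw [Nat.card_eq_fintype_card]
  apply le_antisymm
  · let f : μ.spechtModule F →ₗ[F] {r : Fin μ.card → ℕ // IsLattice μ.rowLen r} → F :=
      LinearMap.pi fun r => Finsupp.lapply (latticeTableau r.2).tabloid ∘ₗ
        (μ.spechtModule F).subtype
    have hf : Function.Injective f := by
      have h0 : ∀ v, f v = 0 → v = 0 := by
        intro v hv
        refine Subtype.ext (eq_zero_of_forall_isLattice v.2 fun T hT => ?_)
        have h1 : (latticeTableau hT).tabloid = T := Tabloid.rowFn_injective rfl
        rw [← h1]
        exact congrFun hv ⟨_, hT⟩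
      exact fun v w h => sub_eq_zero.1 (h0 _ (by rw [map_sub, h, sub_self]))
    have := LinearMap.finrank_le_finrank_of_injective hf
    rwa [Module.finrank_fintype_fun_eq_card] at this
  · have hli : LinearIndependent F
        fun r : {r : Fin μ.card → ℕ // IsLattice μ.rowLen r} =>
          (⟨(latticeTableau r.2).polytabloid F,
            Submodule.subset_span ⟨latticeTableau r.2, rfl⟩⟩ : μ.spechtModule F) :=
      LinearIndependent.of_comp (μ.spechtModule F).subtype (linearIndependent_polytabloid F μ)
    exact hli.fintype_card_le_finrank

end Field

end YoungDiagram

/-! ### Hook removals move beads on the abacus -/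

namespace YoungDiagram

open Finset BetaSet

/-- For `a ≤ i < b` the new bead of row `i` is the old bead of row `i + 1`, so only the old bead of
row `a` disappears and only the new bead of row `b` is added. -/
theorem beta_shift {c c' : ℕ → ℕ} {a b k : ℕ} (hc : Antitone c) (hab : a ≤ b) (hb : b < k)
    (hout : ∀ i, i < a ∨ b < i → c' i = c i) (hin : ∀ i, a ≤ i → i < b → c' i + 1 = c (i + 1)) :
    beta k c' = insert (c' b + (k - 1 - b)) ((beta k c).erase (c a + (k - 1 - a))) := by
  have hinj : ∀ i < k, i ≠ a → c i + (k - 1 - i) ≠ c a + (k - 1 - a) := fun i hi hne h =>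
    hne (beta_injOn k hc (by simpa using hi) (by simpa using hab.trans_lt hb) h)
  ext x
  simp only [mem_insert, mem_erase, mem_beta]
  constructor
  · rintro ⟨i, hi, rfl⟩
    rcases eq_or_ne i b with rfl | hib
    · exact Or.inl rfl
    right
    by_cases hi' : i < a ∨ b < i
    · rw [hout i hi']
      exact ⟨hinj i hi (by omega), i, hi, rfl⟩
    · have h := hin i (by omega) (by omega)
      have : c' i + (k - 1 - i) = c (i + 1) + (k - 1 - (i + 1)) := by omega
      rw [this]
      exact ⟨hinj (i + 1) (by omega) (by omega), i + 1, by omega, rfl⟩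
  · rintro (rfl | ⟨hx, i, hi, rfl⟩)
    · exact ⟨b, hb, rfl⟩
    by_cases hi' : i < a ∨ b < i
    · exact ⟨i, hi, by rw [hout i hi']⟩
    · have hia : i ≠ a := fun h => hx (by rw [h])
      have h := hin (i - 1) (by omega) (by omega)
      rw [Nat.sub_add_cancel (by omega)] at h
      exact ⟨i - 1, by omega, by omega⟩

theorem rowLen_antitone (μ : YoungDiagram) : Antitone μ.rowLen := fun i j h => μ.rowLen_anti i j h

theorem rowLen_eq_zero {μ : YoungDiagram} {k : ℕ} (hk : (k, 0) ∉ μ) {i : ℕ} (hi : k ≤ i) :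
    μ.rowLen i = 0 := by
  have := μ.rowLen_anti k i hi
  rw [mem_iff_lt_rowLen] at hk
  omega

theorem lt_of_mem {μ : YoungDiagram} {k : ℕ} (hk : (k, 0) ∉ μ) {i j : ℕ} (h : (i, j) ∈ μ) :
    i < k := by
  by_contra hi
  rw [mem_iff_lt_rowLen, rowLen_eq_zero hk (not_lt.1 hi)] at h
  exact Nat.not_lt_zero _ h

theorem card_eq_sum_rowLen {μ : YoungDiagram} {k : ℕ} (hk : (k, 0) ∉ μ) :
    μ.card = ∑ i ∈ range k, μ.rowLen i := by
  have hmaps : Set.MapsTo Prod.fst (μ.cells : Set (ℕ × ℕ)) (range k) := by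
    rintro ⟨i, j⟩ h
    simpa using lt_of_mem hk (by simpa using h)
  rw [YoungDiagram.card, card_eq_sum_card_fiberwise hmaps]
  exact sum_congr rfl fun i _ => (rowLen_eq_card μ).symm

theorem excess_beta_rowLen {μ : YoungDiagram} {k : ℕ} (hk : (k, 0) ∉ μ) :
    excess (beta k μ.rowLen) = μ.card := by
  rw [excess_beta k μ.rowLen_antitone, card_eq_sum_rowLen hk]

theorem hasse_adj_iff {x y : ℕ × ℕ} : (SimpleGraph.hasse (ℕ × ℕ)).Adj x y ↔
    (x.1 + 1 = y.1 ∧ x.2 = y.2 ∨ x.2 + 1 = y.2 ∧ x.1 = y.1) ∨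
      (y.1 + 1 = x.1 ∧ y.2 = x.2 ∨ y.2 + 1 = x.2 ∧ y.1 = x.1) := by
  rw [SimpleGraph.hasse_adj, Prod.covBy_iff, Prod.covBy_iff]
  simp only [Nat.covBy_iff_add_one_eq]

theorem mem_sdiff_iff {μ ν : YoungDiagram} {i j : ℕ} :
    (i, j) ∈ μ.cells \ ν.cells ↔ ν.rowLen i ≤ j ∧ j < μ.rowLen i := by
  rw [mem_sdiff, mem_cells, mem_cells, mem_iff_lt_rowLen, mem_iff_lt_rowLen]
  omega

/-- A path from a row at most `i` to a row beyond `i` must cross by a vertical edge. -/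
theorem exists_common_column {s : Set (ℕ × ℕ)}
    (hs : ((SimpleGraph.hasse (ℕ × ℕ)).induce s).Connected) {x y : ℕ × ℕ} (hx : x ∈ s)
    (hy : y ∈ s) {i : ℕ} (hxi : x.1 ≤ i) (hyi : i < y.1) :
    ∃ j, (i, j) ∈ s ∧ (i + 1, j) ∈ s := by
  obtain ⟨q⟩ := hs.preconnected ⟨x, hx⟩ ⟨y, hy⟩
  obtain ⟨⟨⟨⟨⟨u1, u2⟩, hu⟩, ⟨⟨v1, v2⟩, hv⟩⟩, hadj⟩, _, h1, h2⟩ :=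
    q.exists_boundary_dart {z | z.1.1 ≤ i} hxi (not_le.2 hyi)
  replace hadj := hasse_adj_iff.1 (show (SimpleGraph.hasse (ℕ × ℕ)).Adj (u1, u2) (v1, v2) from hadj)
  simp only [Set.mem_ofPred_eq, not_le] at h1 h2 hadj
  obtain ⟨rfl, rfl, rfl⟩ : u1 = i ∧ v1 = i + 1 ∧ v2 = u2 := by omega
  exact ⟨_, hu, hv⟩

theorem IsHookRemoval.card_add {p : ℕ} {μ ν : YoungDiagram} (h : IsHookRemoval p μ ν) :
    ν.card + p = μ.card := by
  have h1 := card_sdiff_add_card_eq_card (cells_subset_iff.2 h.le)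
  rw [h.card_eq] at h1
  rw [add_comm]
  exact h1

theorem IsHookRemoval.beta_eq_move {p : ℕ} (hp : 0 < p) {μ ν : YoungDiagram}
    (h : IsHookRemoval p μ ν) {k : ℕ} (hk : (k, 0) ∉ μ) :
    ∃ x ∈ movable p (beta k μ.rowLen), beta k ν.rowLen = move p (beta k μ.rowLen) x := by
  have hνk : (k, 0) ∉ ν := fun h' => hk (h.le h')
  have hne : (μ.cells \ ν.cells).Nonempty := by rw [← card_pos, h.card_eq]; exact hp
  obtain ⟨⟨a, ja⟩, ha, hmin⟩ := exists_min_image _ Prod.fst hne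
  obtain ⟨⟨b, jb⟩, hb, hmax⟩ := exists_max_image _ Prod.fst hne
  have hab : a ≤ b := hmin _ hb
  have hbk : b < k := lt_of_mem hk ((mem_cells _).1 (mem_sdiff.1 hb).1)
  have hle : ∀ i, ν.rowLen i ≤ μ.rowLen i := by
    intro i
    by_contra! hlt
    exact lt_irrefl _ (mem_iff_lt_rowLen.1 (h.le (mem_iff_lt_rowLen.2 hlt)))
  have hout : ∀ i, i < a ∨ b < i → ν.rowLen i = μ.rowLen i := by
    intro i hi
    by_contra hne
    have hmem : (i, ν.rowLen i) ∈ μ.cells \ ν.cells :=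
      mem_sdiff_iff.2 ⟨le_rfl, lt_of_le_of_ne (hle i) hne⟩
    have h1 := hmin _ hmem
    have h2 := hmax _ hmem
    simp only at h1 h2
    omega
  -- Connectedness makes rows `i` and `i + 1` of the hook share a column, giving `ν_i < μ_{i+1}`;
  -- the rim condition at the first removed box of row `i` gives `μ_{i+1} ≤ ν_i + 1`.
  have hin : ∀ i, a ≤ i → i < b → ν.rowLen i + 1 = μ.rowLen (i + 1) := by
    intro i hai hib
    obtain ⟨j, h1, h2⟩ := exists_common_column h.connected (mem_coe.2 ha) (mem_coe.2 hb) hai hib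
    have h1 := mem_sdiff_iff.1 (mem_coe.1 h1)
    have h2 := mem_sdiff_iff.1 (mem_coe.1 h2)
    have h3 : (i, ν.rowLen i) ∈ μ.rim :=
      h.subset_rim (mem_coe.2 (mem_sdiff_iff.2 ⟨le_rfl, by omega⟩))
    have h4 := h3.2
    rw [mem_iff_lt_rowLen] at h4
    simp only at h4
    omega
  have hshift := beta_shift μ.rowLen_antitone hab hbk hout hin
  set x := μ.rowLen a + (k - 1 - a) with hx
  set z := ν.rowLen b + (k - 1 - b) with hz
  have hxmem : x ∈ beta k μ.rowLen := mem_beta.2 ⟨a, hab.trans_lt hbk, rfl⟩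
  have hzmem : z ∉ (beta k μ.rowLen).erase x := by
    intro hmem
    rw [insert_eq_of_mem hmem] at hshift
    have h1 := congrArg card hshift
    rw [card_beta k ν.rowLen_antitone, card_erase_of_mem hxmem, card_beta k μ.rowLen_antitone] at h1
    omega
  -- The sum of the beads drops by the number of removed boxes, and only one bead has changed.
  have hzx : z + p = x := by
    have h1 := sum_beta k μ.rowLen_antitone
    have h2 := sum_beta k ν.rowLen_antitone
    rw [hshift, sum_insert hzmem, ← card_eq_sum_rowLen hνk] at h2
    rw [← add_sum_erase _ _ hxmem, ← card_eq_sum_rowLen hk] at h1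
    have h3 := h.card_add
    omega
  have hz' : x - p = z := by omega
  refine ⟨x, mem_filter.2 ⟨hxmem, by omega, ?_⟩, by rw [hshift, move, hz']⟩
  rw [hz']
  exact fun hmem => hzmem (mem_erase.2 ⟨by omega, hmem⟩)

/-! ### From movable beads back to hooks. -/

theorem connected_skew {s : Set (ℕ × ℕ)} {f c : ℕ → ℕ} {b : ℕ}
    (hs : ∀ i j, (i, j) ∈ s ↔ f i ≤ j ∧ j < c i) (hrow : ∀ i, f i < c i → i ≤ b)
    (hb : f b < c b) (hstep : ∀ i, f i < c i → i < b → f (i + 1) ≤ f i ∧ f i < c (i + 1)) :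
    ((SimpleGraph.hasse (ℕ × ℕ)).induce s).Connected := by
  set G := (SimpleGraph.hasse (ℕ × ℕ)).induce s
  have hmem : ∀ {i}, f i < c i → (i, f i) ∈ s := fun h => (hs _ _).2 ⟨le_rfl, h⟩
  have hleft : ∀ i (hi : f i < c i) (d : ℕ) (h : (i, f i + d) ∈ s),
      G.Reachable ⟨(i, f i + d), h⟩ ⟨(i, f i), hmem hi⟩ := by
    intro i hi d
    induction d with
    | zero => exact fun _ => SimpleGraph.Reachable.refl _
    | succ d ih =>
      intro h
      have h' : (i, f i + d) ∈ s := by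
        rw [hs] at h ⊢
        omega
      have hadj : G.Adj ⟨(i, f i + (d + 1)), h⟩ ⟨(i, f i + d), h'⟩ := by
        change (SimpleGraph.hasse (ℕ × ℕ)).Adj _ _
        rw [hasse_adj_iff]
        exact Or.inr (Or.inr ⟨rfl, rfl⟩)
      exact hadj.reachable.trans (ih h')
  have hdown : ∀ (d i : ℕ) (hi : f i < c i), i + d = b →
      G.Reachable ⟨(i, f i), hmem hi⟩ ⟨(b, f b), hmem hb⟩ := by
    intro d
    induction d with
    | zero =>
      rintro i hi rfl
      exact SimpleGraph.Reachable.refl _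
    | succ d ih =>
      intro i hi hid
      obtain ⟨h1, h2⟩ := hstep i hi (by omega)
      have h' : (i + 1, f i) ∈ s := (hs _ _).2 ⟨h1, h2⟩
      have hadj : G.Adj ⟨(i, f i), hmem hi⟩ ⟨(i + 1, f i), h'⟩ := by
        change (SimpleGraph.hasse (ℕ × ℕ)).Adj _ _
        rw [hasse_adj_iff]
        exact Or.inl (Or.inl ⟨rfl, rfl⟩)
      refine hadj.reachable.trans (.trans ?_ (ih (i + 1) (h1.trans_lt h2) (by omega)))
      obtain ⟨e, he⟩ := Nat.exists_eq_add_of_le h1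
      have := hleft (i + 1) (h1.trans_lt h2) e (he ▸ h')
      simpa only [← he] using this
  have hall : ∀ x : s, G.Reachable x ⟨(b, f b), hmem hb⟩ := by
    rintro ⟨⟨i, j⟩, h⟩
    have h' := (hs _ _).1 h
    have hi : f i < c i := h'.1.trans_lt h'.2
    obtain ⟨e, rfl⟩ := Nat.exists_eq_add_of_le h'.1
    exact (hleft i hi e h).trans (hdown (b - i) i hi (by have := hrow i hi; omega))
  exact { preconnected := fun x y => (hall x).trans (hall y).symm, nonempty := ⟨⟨_, hmem hb⟩⟩ }

theorem exists_isHookRemoval {p : ℕ} (hp : 0 < p) {μ : YoungDiagram} {k : ℕ} (hk : (k, 0) ∉ μ)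
    {x : ℕ} (hx : x ∈ movable p (beta k μ.rowLen)) : ∃ ν, IsHookRemoval p μ ν := by
  set c := μ.rowLen with hc
  have hanti : ∀ {i j}, i ≤ j → c j ≤ c i := fun h => μ.rowLen_antitone h
  obtain ⟨hxb, hpx, hxp⟩ := mem_filter.1 hx
  obtain ⟨a, hak, hax⟩ := mem_beta.1 hxb
  -- The hook runs from row `a`, whose bead is `x`, down to row `b`, the last one whose bead lies
  -- above the vacant place `x - p`.
  have hne : ((range k).filter fun i => x - p < c i + (k - 1 - i)).Nonempty :=
    ⟨a, mem_filter.2 ⟨mem_range.2 hak, by omega⟩⟩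
  obtain ⟨b, hb, hmax⟩ := exists_max_image _ id hne
  obtain ⟨hbk, hby⟩ := mem_filter.1 hb
  rw [mem_range] at hbk
  have hab : a ≤ b := hmax a (mem_filter.2 ⟨mem_range.2 hak, by omega⟩)
  have hafter : b + 1 < k → c (b + 1) + (k - 1 - (b + 1)) < x - p := by
    intro h
    refine lt_of_le_of_ne (not_lt.1 fun h' => ?_) fun h' => hxp (mem_beta.2 ⟨b + 1, h, h'⟩)
    have := hmax (b + 1) (mem_filter.2 ⟨mem_range.2 h, h'⟩)
    simp only [id] at this
    omega
  have hkc : c k = 0 := rowLen_eq_zero hk le_rfl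
  -- This makes the new length `e` of row `b` a natural number with `c (b + 1) ≤ e`, so the new row
  -- lengths still decrease.
  have hyb : k - 1 - b ≤ x - p ∧ c (b + 1) + (k - 1 - b) ≤ x - p := by
    by_cases h : b + 1 < k
    · have := hafter h
      omega
    · have : b + 1 = k := by omega
      rw [this, hkc]
      omega
  obtain ⟨e, he⟩ : ∃ e, x - p = e + (k - 1 - b) := ⟨x - p - (k - 1 - b), by omega⟩
  let f : ℕ → ℕ := fun i => if i = b then e else if a ≤ i ∧ i < b then c (i + 1) - 1 else c i
  have hfb : f b = e := by simp [f]
  have hin : ∀ i, a ≤ i → i < b → f i + 1 = c (i + 1) := by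
    intro i h1 h2
    have : c b ≤ c (i + 1) := hanti h2
    simp only [f, h2.ne, h1, h2, if_false, and_self, if_true]
    omega
  have hout : ∀ i, i < a ∨ b < i → f i = c i := by
    intro i hi
    simp only [f]
    rw [if_neg (by omega), if_neg (by omega)]
  have hfanti : Antitone f := by
    refine antitone_nat_of_succ_le fun i => ?_
    have h0 := hanti (Nat.le_succ i)
    have h1 := hanti (Nat.le_succ (i + 1))
    have h2 := hin i
    have h3 := hin (i + 1)
    have h4 := hout i
    have h5 := hout (i + 1)
    simp only [Nat.succ_eq_add_one] at h0 h1
    rcases eq_or_ne i b with rfl | hib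
    · rw [hfb]; omega
    rcases eq_or_ne (i + 1) b with hib' | hib'
    · have : f (i + 1) = e := by rw [hib', hfb]
      rw [← hib'] at hby he
      omega
    · omega
  have hfle : ∀ i, f i ≤ c i := by
    intro i
    have h0 := hanti (Nat.le_succ i)
    have h2 := hin i
    have h4 := hout i
    simp only [Nat.succ_eq_add_one] at h0
    rcases eq_or_ne i b with rfl | hib
    · rw [hfb]; omega
    · omega
  let ν : YoungDiagram :=
    { cells := μ.cells.filter fun z => z.2 < f z.1
      isLowerSet := by
        rintro ⟨i, j⟩ ⟨i', j'⟩ ⟨hi, hj⟩ h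
        simp only [coe_filter, Set.mem_ofPred_eq, mem_cells] at h hi hj ⊢
        exact ⟨μ.up_left_mem hi hj h.1, (hj.trans_lt h.2).trans_le (hfanti hi)⟩ }
  have hν : ν.rowLen = f := by
    funext i
    refine eq_of_forall_lt_iff fun j => ?_
    rw [← mem_iff_lt_rowLen, ← mem_cells, mem_filter, mem_cells, mem_iff_lt_rowLen]
    exact and_iff_right_of_imp fun h => lt_of_lt_of_le h (hfle i)
  have hle : ν ≤ μ := cells_subset_iff.1 (filter_subset _ _)
  have hskew : ∀ i j, (i, j) ∈ ((μ.cells \ ν.cells : Finset (ℕ × ℕ)) : Set (ℕ × ℕ)) ↔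
      f i ≤ j ∧ j < c i := fun i j => by rw [mem_coe, mem_sdiff_iff, hν]
  have hrow : ∀ i, f i < c i → a ≤ i ∧ i ≤ b := by
    intro i hi
    by_contra h
    exact hi.ne (hout i (by omega))
  have hfcb : f b < c b := by omega
  refine ⟨ν, hle, ?_, ?_, ?_⟩
  · rintro ⟨i, j⟩ hij
    have hij' := (hskew i j).1 hij
    refine ⟨(mem_cells _).1 (mem_sdiff.1 (mem_coe.1 hij)).1, fun h => ?_⟩
    rw [mem_iff_lt_rowLen, ← hc] at h
    simp only at h
    have h1 := hrow i (by omega)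
    rcases eq_or_ne i b with rfl | hib
    · omega
    · have := hin i h1.1 (by omega)
      omega
  · refine connected_skew hskew (fun i hi => (hrow i hi).2) hfcb fun i hi hib => ?_
    have := hin i (hrow i hi).1 hib
    exact ⟨hfanti (Nat.le_succ i), by omega⟩
  · have hνk : (k, 0) ∉ ν := fun h => hk (hle h)
    have hshift := beta_shift (k := k) μ.rowLen_antitone hab hbk hout hin
    rw [← hc, hfb, ← he, hax, ← hν] at hshift
    have h1 := excess_move hx
    rw [move, ← hshift, excess_beta_rowLen hνk, excess_beta_rowLen hk] at h1
    have h2 := card_sdiff_add_card_eq_card (cells_subset_iff.2 hle)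
    change _ + ν.card = μ.card at h2
    omega

end YoungDiagram

/-! ### The valuation of the dimension -/

namespace YoungDiagram

open Finset BetaSet

theorem IsHookStripping.card_eq {p w : ℕ} {μ γ : YoungDiagram} (h : IsHookStripping p w μ γ) :
    μ.card = γ.card + w * p := by
  induction w generalizing μ with
  | zero =>
    obtain rfl : μ = γ := h
    simp
  | succ w ih =>
    obtain ⟨κ, h1, h2⟩ := h
    rw [← h1.card_add, ih h2]
    ring

theorem IsHookStripping.le {p w : ℕ} {μ γ : YoungDiagram} (h : IsHookStripping p w μ γ) :
    γ ≤ μ := by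
  induction w generalizing μ with
  | zero => exact (show μ = γ from h).ge
  | succ w ih =>
    obtain ⟨κ, h1, h2⟩ := h
    exact (ih h2).trans h1.le

/-- The same number `k` of beads serves along the whole chain, since the diagrams only shrink. -/
theorem IsHookStripping.quotExcess_eq {p : ℕ} (hp : 0 < p) {w k : ℕ} {μ γ : YoungDiagram}
    (h : IsHookStripping p w μ γ) (hk : (k, 0) ∉ μ) :
    quotExcess p (beta k μ.rowLen) = quotExcess p (beta k γ.rowLen) + w := by
  induction w generalizing μ with
  | zero =>
    obtain rfl : μ = γ := h
    simp
  | succ w ih =>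
    obtain ⟨κ, h1, h2⟩ := h
    obtain ⟨x, hx, hmove⟩ := h1.beta_eq_move hp hk
    have h3 := ih h2 fun h' => hk (h1.le h')
    rw [hmove, quotExcess_move hp hx] at h3
    push_cast
    linarith

theorem IsCore.movable_eq_empty {p : ℕ} (hp : 0 < p) {γ : YoungDiagram} (hγ : IsCore p γ)
    {k : ℕ} (hk : (k, 0) ∉ γ) : movable p (beta k γ.rowLen) = ∅ := by
  by_contra h
  obtain ⟨x, hx⟩ := nonempty_iff_ne_empty.2 h
  obtain ⟨ν, hν⟩ := exists_isHookRemoval hp hk hx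
  exact hγ ν hν

/-- The dimension formula for Specht modules in terms of beta sets. -/
theorem finrank_spechtModule_mul_factProd (F : Type*) [Field F] {μ : YoungDiagram} {k : ℕ}
    (hk : (k, 0) ∉ μ) : Module.finrank F (μ.spechtModule F) * factProd (beta k μ.rowLen) =
      μ.card.factorial * diffProd (beta k μ.rowLen) := by
  have h := card_isLattice (k := k) μ.card μ.rowLen μ.rowLen_antitone
    (fun i hi => rowLen_eq_zero hk hi) (card_eq_sum_rowLen hk).symm
  rw [finrank_spechtModule]
  have hf : (factProd (beta k μ.rowLen) : ℚ) ≠ 0 := by exact_mod_cast (factProd_pos _).ne'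
  rw [quot, ← mul_div_assoc, eq_div_iff hf] at h
  exact_mod_cast h

theorem factorization_finrank_spechtModule (F : Type*) [Field F] {p : ℕ} [hp : Fact p.Prime]
    {μ : YoungDiagram} {k : ℕ} (hk : (k, 0) ∉ μ) :
    ((Module.finrank F (μ.spechtModule F)).factorization p : ℤ) =
      μ.card.factorial.factorization p - cost p (beta k μ.rowLen) := by
  have h := finrank_spechtModule_mul_factProd F hk
  have hd := (diffProd_pos (beta k μ.rowLen)).ne'
  have hf := (factProd_pos (beta k μ.rowLen)).ne'
  have h0 : Module.finrank F (μ.spechtModule F) ≠ 0 := by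
    intro h0
    rw [h0, zero_mul] at h
    exact mul_ne_zero (Nat.factorial_ne_zero _) hd h.symm
  have h1 := congrArg (padicValNat p) h
  rw [padicValNat.mul h0 hf, padicValNat.mul (Nat.factorial_ne_zero _) hd] at h1
  rw [Nat.factorization_def _ hp.out, Nat.factorization_def _ hp.out, cost]
  omega

theorem mem_addToFirstRow {γ : YoungDiagram} {m i j : ℕ} :
    (i, j) ∈ γ.addToFirstRow m ↔ (i, j) ∈ γ ∨ i = 0 ∧ j < γ.rowLen 0 + m := by
  rw [← mem_cells]
  simp only [addToFirstRow, mem_union, mem_cells, mem_product, mem_singleton, mem_range]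

theorem rowLen_addToFirstRow (γ : YoungDiagram) (m i : ℕ) :
    (γ.addToFirstRow m).rowLen i = if i = 0 then γ.rowLen 0 + m else γ.rowLen i := by
  refine eq_of_forall_lt_iff fun j => ?_
  rw [← mem_iff_lt_rowLen, mem_addToFirstRow, mem_iff_lt_rowLen]
  split_ifs with h
  · subst h; omega
  · simp [h]

theorem beta_addToFirstRow (γ : YoungDiagram) (m : ℕ) {k : ℕ} (hk : 0 < k) :
    beta k (γ.addToFirstRow m).rowLen =
      insert (γ.rowLen 0 + (k - 1) + m) ((beta k γ.rowLen).erase (γ.rowLen 0 + (k - 1))) := by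
  rw [beta_shift γ.rowLen_antitone le_rfl hk (c' := (γ.addToFirstRow m).rowLen)
    (fun i hi => by rw [rowLen_addToFirstRow, if_neg (by omega)]) (fun i h1 h2 => by omega),
    rowLen_addToFirstRow, if_pos rfl, Nat.sub_zero, add_right_comm]

theorem notMem_colLen_zero (μ : YoungDiagram) : (μ.colLen 0, 0) ∉ μ := fun h =>
  lt_irrefl _ (mem_iff_lt_colLen.1 h)

theorem card_addToFirstRow (γ : YoungDiagram) (m : ℕ) :
    (γ.addToFirstRow m).card = γ.card + m := by
  have hk : (γ.colLen 0 + 1, 0) ∉ γ := fun h =>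
    γ.notMem_colLen_zero (γ.up_left_mem (Nat.le_succ _) le_rfl h)
  have hk' : (γ.colLen 0 + 1, 0) ∉ γ.addToFirstRow m := by
    rw [mem_addToFirstRow]
    simp [hk]
  rw [card_eq_sum_rowLen hk, card_eq_sum_rowLen hk', sum_range_succ', sum_range_succ']
  simp only [rowLen_addToFirstRow, Nat.add_eq_zero_iff, one_ne_zero, and_false, if_false, if_true]
  ring

theorem cost_beta_addToFirstRow {p : ℕ} [hp : Fact p.Prime] {γ : YoungDiagram}
    (hγ : IsCore p γ) {k : ℕ} (hk : (k, 0) ∉ γ) (hk0 : 0 < k) (w : ℕ) :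
    cost p (beta k (γ.addToFirstRow (w * p)).rowLen) = (w * p).factorial.factorization p := by
  rw [beta_addToFirstRow γ _ hk0, cost_insert_add_max (hγ.movable_eq_empty hp.out.pos hk),
    Nat.factorization_def _ hp.out]
  · exact mem_beta.2 ⟨0, hk0, by simp⟩
  · intro y hy
    obtain ⟨i, _, rfl⟩ := mem_beta.1 hy
    have := γ.rowLen_anti 0 i (Nat.zero_le i)
    omega

end YoungDiagram

theorem lemma6p2 {F : Type*} [Field F] {p : ℕ} (hp : p.Prime)
    (γ : YoungDiagram) (hγ : YoungDiagram.IsCore p γ) (w n a b : ℕ)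
    (hn : n = γ.card + w * p)
    (ha : ordProj[p] (Nat.factorial n) = p ^ a)
    (hb : ordProj[p] (Nat.factorial (w * p)) = p ^ b) :
    ordProj[p] (Module.finrank F ((γ.addToFirstRow (w * p)).spechtModule F)) = p ^ (a - b) ∧
    ∀ μ : YoungDiagram, μ ≠ γ.addToFirstRow (w * p) →
      YoungDiagram.HasCoreAndWeight p μ γ w →
      p ^ (a - b) ≤ ordProj[p] (Module.finrank F (μ.spechtModule F)) := by
  have : Fact p.Prime := ⟨hp⟩
  replace ha := Nat.pow_right_injective hp.two_le ha
  replace hb := Nat.pow_right_injective hp.two_le hb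
  constructor
  · have hk : (γ.colLen 0 + 1, 0) ∉ γ := fun h =>
      γ.notMem_colLen_zero (γ.up_left_mem (Nat.le_succ _) le_rfl h)
    have hk' : (γ.colLen 0 + 1, 0) ∉ γ.addToFirstRow (w * p) := by
      rw [YoungDiagram.mem_addToFirstRow]
      simp [hk]
    have h := YoungDiagram.factorization_finrank_spechtModule F (p := p) hk'
    rw [YoungDiagram.card_addToFirstRow, ← hn, YoungDiagram.cost_beta_addToFirstRow hγ hk (Nat.succ_pos _)] at h
    congr 1
    omega
  · intro μ _ hμ
    have hk := μ.notMem_colLen_zero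
    have hq := hμ.2.quotExcess_eq hp.pos hk
    rw [BetaSet.quotExcess_eq_zero (hγ.movable_eq_empty hp.pos fun h => hk (hμ.2.le h)), zero_add] at hq
    have hc := BetaSet.cost_le_of_quotExcess hq
    have h := YoungDiagram.factorization_finrank_spechtModule F (p := p) hk
    rw [← Nat.factorization_def _ hp] at hc
    rw [hμ.2.card_eq, ← hn] at h
    -- The exponent on the right is the integer `a` minus the cost, hence at least `a - b`; being a
    -- natural number, it also dominates the truncated difference.
    exact Nat.pow_le_pow_right hp.pos (by omega)
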